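/- A tree story $\langle T,\tau,W\rangle$ consists of a finite tree $T$ with $n$ vertices, a bijection $\tau\colon V(T)\to\{1,\dots,n\}$ and an integer window size $W\ge 1$. For $1\le t\le n+W-1$, let $T_t$ be the subgraph of $T$ induced by $\{v\in V(T): t-W<\tau(v)\le t\}$. A drawing story is a sequence $\Gamma_1,\dots,\Gamma_{n+W-1}$ in which $\Gamma_t$ is a drawing of $T_t$ in the plane (vertices are mapped to distinct points and edges to Jordan arcs between their end-points), such that every vertex has the same position, and every edge is the same curve, in all the drawings in which it appears. It is planar if in each $\Gamma_t$ two distinct arcs meet only at a common end-point and no arc passes through a vertex other than its end-points; it is straight-line if all arcs are straight-line segments; it lies on a $w\times h$ grid if there are integers $a<b$, $c<d$ with $b-a+1=w$ and $d-c+1=h$ such that all vertices of all $\Gamma_t$ have integer coordinates and all $\Gamma_t$ are contained in $[a,b]\times[c,d]$. **Theorem.** For every tree story $\langle T,\tau,W\rangle$ such that $T$ has $n$ vertices, there is a drawing story that is planar, straight-line, and lies on an $(8W+1)\times(8W+1)$ grid, and such a drawing story can be constructed in $O(n)$ time. More precisely, there are a single program for a word RAM (unit-cost addition, truncated subtraction,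 multiplication, integer division, comparison and indirect addressing) and a constant $C$ such that, for every tree story on the vertices $0,\dots,n-1$, given by $n$, $W$, the table of $\tau$ and a list of the edges of $T$, the program halts after at most $C\,n$ steps, uses only words with values at most $C(n+W)$, and outputs, for each vertex, the two coordinates of its position in such a drawing story. -/

import Mathlib

namespace StoryDrawing

/-! ### Drawings of graphs in the plane -/

/-- The set `A` is a Jordan arc (a simple curve) with end-points `p` and `q`. -/
def IsJordanArc (A : Set (ℝ × ℝ)) (p q : ℝ × ℝ) : Prop :=
  ∃ γ : Path p q, Function.Injective γ ∧ Set.range γ = A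

/-- A drawing of the graph `H` (a subgraph of an ambient graph `G`) maps the vertices of `H` to
distinct points of the plane and every edge of `H` to a Jordan arc between its end-points.
The values of `point` and `arc` off the vertices and edges of `H` carry no meaning. -/
structure Drawing {V : Type*} {G : SimpleGraph V} (H : G.Subgraph) where
  point : V → ℝ × ℝ
  arc : Sym2 V → Set (ℝ × ℝ)
  point_injOn : Set.InjOn point H.verts
  arc_joins : ∀ u v : V, H.Adj u v → IsJordanArc (arc s(u, v)) (point u) (point v)

namespace Drawing

variable {V : Type*} {G : SimpleGraph V} {H : G.Subgraph}

/-- Every edge is drawn as the straight-line segment between its end-points. -/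
def StraightLine (D : Drawing H) : Prop :=
  ∀ u v : V, H.Adj u v → D.arc s(u, v) = segment ℝ (D.point u) (D.point v)

/-- Two distinct arcs meet only in the image of a common end-vertex, and an arc passes through
no vertex other than its two end-vertices. -/
def Planar (D : Drawing H) : Prop :=
  (∀ e ∈ H.edgeSet, ∀ f ∈ H.edgeSet, e ≠ f →
    ∀ x ∈ D.arc e ∩ D.arc f, ∃ v : V, v ∈ e ∧ v ∈ f ∧ x = D.point v) ∧
  (∀ e ∈ H.edgeSet, ∀ v ∈ H.verts, D.point v ∈ D.arc e → v ∈ e)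

/-- Every vertex is mapped to a point with integer coordinates. -/
def IsGridDrawing (D : Drawing H) : Prop :=
  ∀ v ∈ H.verts, ∃ x y : ℤ, D.point v = ((x : ℝ), (y : ℝ))

/-- The drawing is enclosed by the bounding box of the grid `[a, b] × [c, d]`. -/
def EnclosedBy (D : Drawing H) (a b c d : ℤ) : Prop :=
  (∀ v ∈ H.verts, D.point v ∈ Set.Icc (a : ℝ) b ×ˢ Set.Icc (c : ℝ) d) ∧
  (∀ e ∈ H.edgeSet, D.arc e ⊆ Set.Icc (a : ℝ) b ×ˢ Set.Icc (c : ℝ) d)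

end Drawing

/-! ### Graph stories and drawing stories -/

/-- A graph story: a finite graph, a bijective labelling of its vertices by `1, …, |V|` (the
time at which a vertex appears), and a positive window size. -/
structure GraphStory (V : Type*) [Fintype V] where
  graph : SimpleGraph V
  time : V → ℕ
  window : ℕ
  time_bijOn : Set.BijOn time Set.univ (Set.Icc 1 (Fintype.card V))
  window_pos : 0 < window

namespace GraphStory

variable {V : Type*} [Fintype V]

/-- A tree story is a graph story whose graph is a tree. -/
def IsTreeStory (S : GraphStory V) : Prop := S.graph.IsTree

/-- The graph at time `t`, induced by the vertices `v` with `t - W < τ(v) ≤ t`. -/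
def snapshot (S : GraphStory V) (t : ℕ) : S.graph.Subgraph :=
  (⊤ : S.graph.Subgraph).induce {v | t < S.time v + S.window ∧ S.time v ≤ t}

end GraphStory

/-- A drawing story: a drawing of the snapshot at each of the times `1, …, |V| + W - 1`, such
that a vertex has the same position, and an edge is the same curve, in all the drawings in
which it appears. -/
structure DrawingStory {V : Type*} [Fintype V] (S : GraphStory V) where
  drawing : ∀ t : Set.Icc 1 (Fintype.card V + S.window - 1), Drawing (S.snapshot t)
  point_eq : ∀ t t' : Set.Icc 1 (Fintype.card V + S.window - 1), ∀ v : V,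
    v ∈ (S.snapshot t).verts → v ∈ (S.snapshot t').verts →
      (drawing t).point v = (drawing t').point v
  arc_eq : ∀ t t' : Set.Icc 1 (Fintype.card V + S.window - 1), ∀ e : Sym2 V,
    e ∈ (S.snapshot t).edgeSet → e ∈ (S.snapshot t').edgeSet →
      (drawing t).arc e = (drawing t').arc e

namespace DrawingStory

variable {V : Type*} [Fintype V] {S : GraphStory V}

def Planar (Γ : DrawingStory S) : Prop := ∀ t, (Γ.drawing t).Planar

def StraightLine (Γ : DrawingStory S) : Prop := ∀ t, (Γ.drawing t).StraightLine

/-- All the drawings of the story are grid drawings, and they all lie on one and the same grid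
of width `w` and height `h`. -/
def LiesOnGridOfSize (Γ : DrawingStory S) (w h : ℕ) : Prop :=
  ∃ a b c d : ℤ, a < b ∧ c < d ∧ b - a + 1 = w ∧ d - c + 1 = h ∧
    ∀ t, (Γ.drawing t).IsGridDrawing ∧ (Γ.drawing t).EnclosedBy a b c d

end DrawingStory

/-! ### A word random access machine with a step count

Programs are imperative programs over finitely many variables and finitely many
one-dimensional arrays (the names occurring in the program text), all holding natural numbers.
A program can use a value only if it is at most the word bound `B`. -/

/-- The memory: the content of the variables and of the arrays. -/
structure Memory where
  var : ℕ → ℕ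
  arr : ℕ → ℕ → ℕ

namespace Memory

def setVar (m : Memory) (x k : ℕ) : Memory :=
  { m with var := Function.update m.var x k }

def setArr (m : Memory) (a i k : ℕ) : Memory :=
  { m with arr := Function.update m.arr a (Function.update (m.arr a) i k) }

end Memory

/-- The arithmetic and comparison operations of the machine. -/
inductive BinOp where
  | add | sub | mul | div | lt | eq

/-- Subtraction is truncated at `0`, division rounds down, and a comparison yields `1` or `0`. -/
def BinOp.apply : BinOp → ℕ → ℕ → ℕ
  | .add, i, j => i + j
  | .sub, i, j => i - j
  | .mul, i, j => i * j
  | .div, i, j => i / j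
  | .lt, i, j => if i < j then 1 else 0
  | .eq, i, j => if i = j then 1 else 0

/-- Expressions; `read a e` is the entry of the array `a` at the index given by `e`. -/
inductive Expr where
  | lit (k : ℕ)
  | var (x : ℕ)
  | read (a : ℕ) (e : Expr)
  | bin (op : BinOp) (e₁ e₂ : Expr)

namespace Expr

def eval (m : Memory) : Expr → ℕ
  | lit k => k
  | var x => m.var x
  | read a e => m.arr a (e.eval m)
  | bin op e₁ e₂ => op.apply (e₁.eval m) (e₂.eval m)

/-- The number of steps needed to evaluate an expression: one per node. -/
def steps : Expr → ℕ
  | lit _ => 1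
  | var _ => 1
  | read _ e => e.steps + 1
  | bin _ e₁ e₂ => e₁.steps + e₂.steps + 1

/-- All the values (array indices included) that arise in the evaluation are at most `B`. -/
def Fits (B : ℕ) (m : Memory) : Expr → Prop
  | lit k => k ≤ B
  | var x => m.var x ≤ B
  | read a e => e.Fits B m ∧ m.arr a (e.eval m) ≤ B
  | bin op e₁ e₂ => e₁.Fits B m ∧ e₂.Fits B m ∧ op.apply (e₁.eval m) (e₂.eval m) ≤ B

end Expr

/-- Programs. -/
inductive Program where
  | skip
  | assign (x : ℕ) (e : Expr)
  | store (a : ℕ) (i e : Expr)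
  | seq (p q : Program)
  | ite (e : Expr) (p q : Program)
  | loop (e : Expr) (p : Program)

/-- `Run B p m m' t`: on words bounded by `B`, the program `p` started on the memory `m` halts
after `t` steps with the memory `m'`.  A condition holds if its value is not `0`; `loop` is the
while-loop. -/
inductive Run (B : ℕ) : Program → Memory → Memory → ℕ → Prop where
  | skip (m : Memory) : Run B .skip m m 1
  | assign (m : Memory) (x : ℕ) (e : Expr) : e.Fits B m →
      Run B (.assign x e) m (m.setVar x (e.eval m)) (e.steps + 1)
  | store (m : Memory) (a : ℕ) (i e : Expr) : i.Fits B m → e.Fits B m →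
      Run B (.store a i e) m (m.setArr a (i.eval m) (e.eval m)) (i.steps + e.steps + 1)
  | seq (p q : Program) (m m' m'' : Memory) (t t' : ℕ) : Run B p m m' t → Run B q m' m'' t' →
      Run B (.seq p q) m m'' (t + t')
  | ite_true (e : Expr) (p q : Program) (m m' : Memory) (t : ℕ) : e.Fits B m → e.eval m ≠ 0 →
      Run B p m m' t → Run B (.ite e p q) m m' (e.steps + 1 + t)
  | ite_false (e : Expr) (p q : Program) (m m' : Memory) (t : ℕ) : e.Fits B m → e.eval m = 0 →
      Run B q m m' t → Run B (.ite e p q) m m' (e.steps + 1 + t)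
  | loop_true (e : Expr) (p : Program) (m m' m'' : Memory) (t t' : ℕ) : e.Fits B m →
      e.eval m ≠ 0 → Run B p m m' t → Run B (.loop e p) m' m'' t' →
      Run B (.loop e p) m m'' (e.steps + 1 + t + t')
  | loop_false (e : Expr) (p : Program) (m : Memory) : e.Fits B m → e.eval m = 0 →
      Run B (.loop e p) m m (e.steps + 1)

/-! ### Input and output of the drawing algorithm -/

/-- `E` lists every edge of `G` exactly once, in any order and with any orientation. -/
def IsEdgeList {V : Type*} (G : SimpleGraph V) (E : List (V × V)) : Prop :=
  (E.map fun e => s(e.1, e.2)).Nodup ∧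
    ∀ e : Sym2 V, e ∈ G.edgeSet ↔ e ∈ E.map fun e => s(e.1, e.2)

/-- The initial memory for a graph story on the vertices `0, …, n - 1`: the variables `0` and `1`
hold `n` and the window size, the array `0` holds the appearance times, and the arrays `1` and
`2` hold the first and the second end-vertices of the listed edges.  Everything else is `0`. -/
def inputMemory {n : ℕ} (S : GraphStory (Fin n)) (E : List (Fin n × Fin n)) : Memory where
  var x := if x = 0 then n else if x = 1 then S.window else 0
  arr a i :=
    if a = 0 then (if h : i < n then S.time ⟨i, h⟩ else 0)
    else if a = 1 then (if h : i < E.length then (E[i].1 : ℕ) else 0)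
    else if a = 2 then (if h : i < E.length then (E[i].2 : ℕ) else 0)
    else 0

/-- The memory `m` represents the straight-line drawing story `Γ`: the coordinates of every
vertex `v` are stored at the index `v` of the arrays `3` and `4`. -/
def Represents {n : ℕ} {S : GraphStory (Fin n)} (m : Memory) (Γ : DrawingStory S) : Prop :=
  Γ.StraightLine ∧
    ∀ t : Set.Icc 1 (Fintype.card (Fin n) + S.window - 1), ∀ v ∈ (S.snapshot t).verts,
      (Γ.drawing t).point v = ((m.arr 3 v : ℝ), (m.arr 4 v : ℝ))

end StoryDrawing

/-! Cut the times into buckets of `W` consecutive times; a window meets at most two buckets, and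
these are consecutive. Root the tree and give each vertex a rank `i < W` in its bucket, a depth `d`
inside its component of the forest induced by the bucket, and one of four rays from the centre `(4W,
4W)`. The ray turns by a right angle whenever a tree edge passes to an adjacent bucket. In the frame
of its ray the vertex is placed at `(2W + 2(i - d), d)`.

A child in another bucket is the root of its component, so it has depth `0` and lies on its ray.
Hence every visible edge stays in the closed quadrant between the ray of its parent and the next
ray, meets the first ray at most in the parent and the second at most in the child
(`edge_quadrant`). Edges with parents on different rays therefore meet only in common vertices
(`eq_or_adjacent_of_quadrants`, `point_inj`). The parity of ray plus bucket is constant, so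
simultaneously visible vertices on one ray share a bucket.

What remains is geometry in one frame. In the coordinates `(x/2 + y - W, y)` a vertex is `(i, d)`,
and an edge to a child of rank `j` on the next ray ends at `(W + 2j, 2W + 2j)`, so its slope exceeds
`1`. If ranks follow a preorder of the components, depth grows by at most one per rank, so such
steep edges avoid the edges inside the bucket (`inEdge_outEdge_meet`), and the latter do not cross
each other (`inEdges_meet`). Two steep edges do not cross if the children have the order of their
parents (`outEdges_meet`).

Both orders come from one traversal: children in the same bucket go on a stack, all other children
into a queue that is used only when the stack is empty. The stack gives the preorder, the queue the
agreement of orders; `inv_visit` preserves the invariant and `Inv.isLayout` extracts the layout.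
Finally, `drawProgram` simulates the traversal on linked adjacency lists, and its cost is linear
because the degrees sum to `2(n - 1)`. -/

namespace StoryDrawing

/-! ### Placement on four rays and their quadrants -/

/-- The grid point of a vertex with rank `i`, depth `d` and ray `r`. -/
def gridPoint (W i d r : ℕ) : ℕ × ℕ :=
  if r = 0 then (4 * W + (2 * W + 2 * (i - d)), 4 * W + d)
  else if r = 1 then (4 * W - d, 4 * W + (2 * W + 2 * (i - d)))
  else if r = 2 then (4 * W - (2 * W + 2 * (i - d)), 4 * W - d)
  else (4 * W + d, 4 * W - (2 * W + 2 * (i - d)))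

/-- Coordinates with respect to the frame centred at `(4W, 4W)` and rotated by `r` right angles. -/
def rayFrame (W : ℝ) (r : ℕ) (z : ℝ × ℝ) : ℝ × ℝ :=
  if r = 0 then (z.1 - 4 * W, z.2 - 4 * W)
  else if r = 1 then (z.2 - 4 * W, 4 * W - z.1)
  else if r = 2 then (4 * W - z.1, 4 * W - z.2)
  else (4 * W - z.2, z.1 - 4 * W)

theorem gridPoint_le {W i d r : ℕ} (hd : d ≤ i) (hi : i < W) :
    (gridPoint W i d r).1 ≤ 8 * W ∧ (gridPoint W i d r).2 ≤ 8 * W := by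
  unfold gridPoint
  split_ifs <;> constructor <;> simp only <;> omega

/-- The real point at the grid point of a vertex. -/
def realPoint (W i d r : ℕ) : ℝ × ℝ := ((gridPoint W i d r).1, (gridPoint W i d r).2)

theorem rayFrame_realPoint {W i d r : ℕ} (hd : d ≤ i) (hi : i < W) :
    rayFrame W r (realPoint W i d r) = (2 * W + 2 * ((i : ℝ) - d), (d : ℝ)) := by
  have h1 : d ≤ 4 * W := by omega
  have h2 : 2 * W + 2 * (i - d) ≤ 4 * W := by omega
  unfold rayFrame realPoint gridPoint
  split_ifs <;> simp [Nat.cast_sub h1, Nat.cast_sub h2, Nat.cast_sub hd]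

theorem rayFrame_segment (W : ℝ) (r : ℕ) (p q : ℝ × ℝ) (t : ℝ) :
    rayFrame W r (AffineMap.lineMap p q t) = AffineMap.lineMap (rayFrame W r p) (rayFrame W r q) t := by
  unfold rayFrame
  split_ifs <;> ext <;> simp [AffineMap.lineMap_apply] <;> ring

/-- Consecutive frames differ by a quarter turn. This puts a point of the next ray on the second
axis of the current frame. -/
theorem rayFrame_succ (W : ℝ) {r : ℕ} (hr : r < 4) (z : ℝ × ℝ) :
    rayFrame W ((r + 1) % 4) z = ((rayFrame W r z).2, -(rayFrame W r z).1) := by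
  unfold rayFrame
  interval_cases r <;> simp

/-- A point lies in at most two of the four closed quadrants, and then on their common ray. -/
theorem eq_or_adjacent_of_quadrants {W : ℝ} {r s : ℕ} (hr : r < 4) (hs : s < 4) {z : ℝ × ℝ}
    (hz : z ≠ (4 * W, 4 * W))
    (h1 : 0 ≤ (rayFrame W r z).1) (h2 : 0 ≤ (rayFrame W r z).2)
    (h3 : 0 ≤ (rayFrame W s z).1) (h4 : 0 ≤ (rayFrame W s z).2) :
    r = s ∨ (s = (r + 1) % 4 ∧ (rayFrame W r z).1 = 0 ∧ (rayFrame W s z).2 = 0) ∨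
      (r = (s + 1) % 4 ∧ (rayFrame W s z).1 = 0 ∧ (rayFrame W r z).2 = 0) := by
  obtain ⟨x, y⟩ := z
  have hz' : x = 4 * W → y ≠ 4 * W := by
    rintro rfl rfl; exact hz rfl
  unfold rayFrame at *
  interval_cases r <;> interval_cases s <;> simp at h1 h2 h3 h4 ⊢ <;>
    first
    | constructor <;> linarith
    | exact hz' (by linarith) (by linarith)

end StoryDrawing

namespace StoryDrawing

/-! ### Disjointness of edges in one frame -/

/-- Two edges to the next ray: `(i, d)` are rank and depth of the parents, `j` the ranks of the
children. -/
theorem outEdges_meet {W i d j t i' d' j' t' : ℝ} (hd : d ≤ i) (hi : i < W) (hd0 : 0 ≤ d)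
    (hj : 0 ≤ j) (ht' : 0 ≤ t') (ht1 : t' ≤ 1)
    (hii : i ≤ i') (hdd : d' - d ≤ i' - i) (hjj : j < j')
    (hx : (1 - t) * (2 * W + 2 * (i - d)) = (1 - t') * (2 * W + 2 * (i' - d')))
    (hy : d + t * (2 * W + 2 * j - d) = d' + t' * (2 * W + 2 * j' - d')) :
    t' = 0 ∧ i = i' := by
  -- In the coordinates `(x/2 + y - W, y)` the first edge starts at `(i, d)` and has direction `(A,
  -- B)`, of slope greater than `1`.
  set A := W + 2 * j - i with hA
  set B := 2 * W + 2 * j - d with hB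
  have hA0 : 0 < A := by linarith
  have hAB : A < B := by linarith
  -- The cross product of `(A, B)` with the vector from `(i, d)` to the common point vanishes. It is
  -- the convex combination of the cross products for the two ends of the second edge. Both are
  -- nonnegative, the one at the child strictly positive, which forces `t' = 0`.
  have key : (1 - t') * ((i' - i) * B - (d' - d) * A) + t' * (2 * (j' - j)) * (B - A) = 0 := by
    have e1 : (1 - t') * (i' - i) + t' * (W + 2 * j' - i) = t * A := by
      simp only [hA]; linear_combination (-1 / 2) * hx - hy
    have e2 : (1 - t') * (d' - d) + t' * (2 * W + 2 * j' - d) = t * B := by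
      simp only [hB]; linear_combination -hy
    have e3 : ((1 - t') * (i' - i) + t' * (W + 2 * j' - i)) * B
        - ((1 - t') * (d' - d) + t' * (2 * W + 2 * j' - d)) * A = 0 := by
      rw [e1, e2]; ring
    have : W + 2 * j' - i = A + 2 * (j' - j) := by simp only [hA]; ring
    rw [this] at e3
    have : 2 * W + 2 * j' - d = B + 2 * (j' - j) := by simp only [hB]; ring
    rw [this] at e3
    linear_combination e3
  have n1 : (i' - i) * (B - A) ≤ (i' - i) * B - (d' - d) * A := by
    linarith [mul_le_mul_of_nonneg_right hdd hA0.le]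
  have n2 : 0 ≤ (i' - i) * (B - A) := mul_nonneg (by linarith) (by linarith)
  have n3 : 0 ≤ t' * (2 * (j' - j)) * (B - A) :=
    mul_nonneg (mul_nonneg ht' (by linarith)) (by linarith)
  have n4 : 0 ≤ (1 - t') * ((i' - i) * B - (d' - d) * A) := mul_nonneg (by linarith) (by linarith)
  have ht0 : t' = 0 := by
    have : t' * (2 * (j' - j)) * (B - A) = 0 := by linarith
    rcases mul_eq_zero.1 this with h | h
    · rcases mul_eq_zero.1 h with h | h
      · exact h
      · linarith
    · linarith
  refine ⟨ht0, ?_⟩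
  have : (i' - i) * (B - A) = 0 := by
    rw [ht0] at key; linarith
  rcases mul_eq_zero.1 this with h | h <;> linarith

/-- An edge inside a bucket from `(i, d)` to `(c, d + 1)` and an edge from `(k, e)` to the next
ray. -/
theorem inEdge_outEdge_meet {W i d c t k e j s : ℝ} (hic : i < c)
    (hk : k < W) (he : e ≤ k) (he0 : 0 ≤ e)
    (hj : 0 ≤ j) (hs : 0 ≤ s) (ht : 0 ≤ t) (ht1 : t ≤ 1)
    (hlow : k ≤ i → d - e ≤ i - k) (hlow' : k ≤ i → d + 1 - e ≤ c - k)
    (hmid : i < k → k < c → d + 1 ≤ e)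
    (hx : 2 * W + 2 * ((i - d) + t * (c - i - 1)) = (1 - s) * (2 * W + 2 * (k - e)))
    (hy : d + t = e + s * (2 * W + 2 * j - e)) :
    (t = 0 ∧ k = i) ∨ (t = 1 ∧ k = c) := by
  set A := W + 2 * j - k with hA
  set B := 2 * W + 2 * j - e with hB
  have hA0 : 0 < A := by linarith
  have hB0 : 0 < B := by linarith
  -- Equality of the coordinate `x/2 + y - W`, which interpolates the ranks along the inner edge and
  -- never falls below `k` on the leaving edge.
  have ea : i + t * (c - i) = k + s * A := by simp only [hA]; linear_combination (1 / 2) * hx + hy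
  have hsA : 0 ≤ s * A := mul_nonneg hs hA0.le
  have hsB : 0 ≤ s * B := mul_nonneg hs hB0.le
  rcases le_or_gt k i with hki | hki
  · left
    have hAB : A < B := by linarith
    have h1 := hlow hki
    have h2 := hlow' hki
    -- The same cross product argument: both ends of the inner edge lie on or below the line of
    -- slope `1` through `(k, e)`, hence on one side of the steeper leaving edge.
    have key : (1 - t) * ((i - k) * B - (d - e) * A) + t * ((c - k) * B - (d + 1 - e) * A) = 0 := by
      have e1 : (1 - t) * (i - k) + t * (c - k) = s * A := by linarith
      have e2 : (1 - t) * (d - e) + t * (d + 1 - e) = s * B := by linarith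
      have e3 : ((1 - t) * (i - k) + t * (c - k)) * B
        - ((1 - t) * (d - e) + t * (d + 1 - e)) * A = 0 := by rw [e1, e2]; ring
      linear_combination e3
    have n1 : (i - k) * (B - A) ≤ (i - k) * B - (d - e) * A := by
      linarith [mul_le_mul_of_nonneg_right h1 hA0.le]
    have n2 : (c - k) * (B - A) ≤ (c - k) * B - (d + 1 - e) * A := by
      linarith [mul_le_mul_of_nonneg_right h2 hA0.le]
    have n3 : 0 ≤ (i - k) * (B - A) := mul_nonneg (by linarith) (by linarith)
    have n4 : 0 < (c - k) * (B - A) := mul_pos (by linarith) (by linarith)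
    have n5 : 0 ≤ (1 - t) * ((i - k) * B - (d - e) * A) := mul_nonneg (by linarith) (by linarith)
    have n6 : 0 ≤ t * ((c - k) * B - (d + 1 - e) * A) := mul_nonneg (by linarith) (by linarith)
    have ht0 : t = 0 := by
      have : t * ((c - k) * B - (d + 1 - e) * A) = 0 := by linarith
      rcases mul_eq_zero.1 this with h | h
      · exact h
      · linarith
    refine ⟨ht0, ?_⟩
    have : (i - k) * (B - A) = 0 := by
      rw [ht0] at key; linarith
    rcases mul_eq_zero.1 this with h | h <;> linarith
  · right
    -- If `c ≤ k`, the rank coordinates can agree only at `c`. If `i < k < c`, the inner edge stays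
    -- at height at most `d + 1 ≤ e`, so heights can agree only at its upper end and at the start of
    -- the leaving edge.
    rcases le_or_gt c k with hck | hck
    · have : t * (c - i) ≤ 1 * (c - i) := mul_le_mul_of_nonneg_right ht1 (by linarith)
      have h1 : t * (c - i) = 1 * (c - i) := by linarith
      have h2 : t = 1 := mul_right_cancel₀ (by linarith : c - i ≠ 0) h1
      exact ⟨h2, by linarith⟩
    · have h1 := hmid hki hck
      have h2 : t = 1 := by linarith
      have h3 : s * B = 0 := by linarith
      have h4 : s = 0 := by
        rcases mul_eq_zero.1 h3 with h | h
        · exact h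
        · linarith
      rw [h2, h4] at ea
      exact ⟨h2, by linarith⟩

/-- Two edges inside a bucket. -/
theorem inEdges_meet {W i d c t i' d' c' t' : ℝ} (hic : i < c) (hic' : i' < c')
    (ht : 0 ≤ t) (ht1 : t ≤ 1) (ht' : 0 ≤ t') (ht1' : t' ≤ 1)
    (hdd : d = d' ∨ d + 1 ≤ d' ∨ d' + 1 ≤ d)
    (hsep : d = d' → i < i' → c < i') (hsep' : d = d' → i' < i → c' < i)
    (hx : 2 * W + 2 * ((i - d) + t * (c - i - 1)) = 2 * W + 2 * ((i' - d') + t' * (c' - i' - 1)))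
    (hy : d + t = d' + t') :
    (t = 1 ∧ t' = 0 ∧ c = i') ∨ (t = 0 ∧ t' = 1 ∧ i = c') ∨ (t = 0 ∧ t' = 0 ∧ i = i') ∨
      (i = i' ∧ c = c') := by
  have ea : i + t * (c - i) = i' + t' * (c' - i') := by linarith
  -- Each inner edge fills one unit of height. Edges of different levels meet at most at their ends;
  -- on equal levels the parameters agree, and the disjoint rank intervals separate the edges unless
  -- they have the same parent.
  rcases hdd with h | h | h
  · have htt : t = t' := by linarith
    subst htt
    rcases lt_trichotomy i i' with h1 | h1 | h1
    · have := hsep h h1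
      have h2 : t * (c - i) ≤ 1 * (c - i) := mul_le_mul_of_nonneg_right ht1 (by linarith)
      have h3 : 0 ≤ t * (c' - i') := mul_nonneg ht (by linarith)
      linarith
    · subst h1
      have h2 : t * (c - c') = 0 := by linarith
      rcases mul_eq_zero.1 h2 with h3 | h3
      · simp [h3]
      · right; right; right; exact ⟨rfl, by linarith⟩
    · have := hsep' h h1
      have h2 : t * (c' - i') ≤ 1 * (c' - i') := mul_le_mul_of_nonneg_right ht1 (by linarith)
      have h3 : 0 ≤ t * (c - i) := mul_nonneg ht (by linarith)
      linarith
  · have h1 : t = 1 := by linarith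
    have h2 : t' = 0 := by linarith
    rw [h1, h2] at ea
    left; exact ⟨h1, h2, by linarith⟩
  · have h1 : t' = 1 := by linarith
    have h2 : t = 0 := by linarith
    rw [h1, h2] at ea
    right; left; exact ⟨h2, h1, by linarith⟩

end StoryDrawing

namespace StoryDrawing

/-! ### Layouts of rooted forests whose vertices are partitioned into buckets -/

/-- Rank inside the bucket, depth and ray of every vertex, with the properties that make the
placement of the vertices by `gridPoint` planar. -/
structure IsLayout {V : Type*} (W : ℕ) (child : V → V → Prop) (bucket idx dep ray : V → ℕ) :
    Prop where
  child_unique : ∀ {p p' c}, child p c → child p' c → p = p'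
  idx_lt : ∀ v, idx v < W
  idx_inj : ∀ {u v}, bucket u = bucket v → idx u = idx v → u = v
  dep_le : ∀ {u v}, bucket u = bucket v → idx u ≤ idx v → dep v + idx u ≤ dep u + idx v
  dep_le_idx : ∀ v, dep v ≤ idx v
  in_dep : ∀ {p c}, child p c → bucket p = bucket c → dep c = dep p + 1
  in_ray : ∀ {p c}, child p c → bucket p = bucket c → ray c = ray p
  in_idx : ∀ {p c}, child p c → bucket p = bucket c → idx p < idx c
  in_between : ∀ {p c k}, child p c → bucket p = bucket c → bucket k = bucket p →
    idx p < idx k → idx k ≤ idx c → dep c ≤ dep k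
  out_dep : ∀ {p c}, child p c → bucket p ≠ bucket c → dep c = 0
  out_ray : ∀ {p c}, child p c → bucket c = bucket p + 1 ∨ bucket p = bucket c + 1 →
    ray c = (ray p + 1) % 4
  out_idx : ∀ {p c p' c'}, child p c → child p' c' → bucket p = bucket p' →
    bucket c = bucket c' → bucket p ≠ bucket c → idx p < idx p' → idx c < idx c'
  ray_lt : ∀ v, ray v < 4
  ray_parity : ∀ u v, (ray u + bucket u) % 2 = (ray v + bucket v) % 2

/-! ### Planarity of a layout -/

namespace IsLayout

variable {V : Type*} {W : ℕ} {child : V → V → Prop} {bucket idx dep ray : V → ℕ}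

/-- The buckets of two vertices are equal or consecutive. -/
def Near (bucket : V → ℕ) (u v : V) : Prop := bucket u ≤ bucket v + 1 ∧ bucket v ≤ bucket u + 1

/-- Consecutive buckets have different parities, whereas ray plus bucket has constant parity. -/
theorem bucket_eq (L : IsLayout W child bucket idx dep ray) {u v : V} (h : Near bucket u v)
    (hr : ray u = ray v) : bucket u = bucket v := by
  have := L.ray_parity u v
  unfold Near at h
  omega

theorem frame_point (L : IsLayout W child bucket idx dep ray) (v : V) :
    rayFrame W (ray v) (realPoint W (idx v) (dep v) (ray v)) =
      (2 * W + 2 * ((idx v : ℝ) - dep v), (dep v : ℝ)) :=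
  rayFrame_realPoint (L.dep_le_idx v) (L.idx_lt v)

theorem dep_le_cast (L : IsLayout W child bucket idx dep ray) (v : V) :
    (0 : ℝ) ≤ dep v ∧ (dep v : ℝ) ≤ idx v ∧ (idx v : ℝ) < W :=
  ⟨Nat.cast_nonneg _, by exact_mod_cast L.dep_le_idx v, by exact_mod_cast L.idx_lt v⟩

theorem ne_centre {r : ℕ} {z : ℝ × ℝ} (h : 0 < (rayFrame W r z).1 ∨ 0 < (rayFrame W r z).2) :
    z ≠ (4 * (W : ℝ), 4 * (W : ℝ)) := by
  rintro rfl
  unfold rayFrame at h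
  split_ifs at h <;> simp at h

/-- A vertex has positive first coordinate in its own frame, so it is never on the next ray. Thus
equal points have equal rays, hence equal buckets, and their frame coordinates give back the rank.
-/
theorem point_inj (L : IsLayout W child bucket idx dep ray) {u v : V} (h : Near bucket u v)
    (huv : realPoint W (idx u) (dep u) (ray u) = realPoint W (idx v) (dep v) (ray v)) : u = v := by
  have hu := L.frame_point u
  have hv := L.frame_point v
  rw [← huv] at hv
  obtain ⟨u0, u1, u2⟩ := L.dep_le_cast u
  obtain ⟨v0, v1, v2⟩ := L.dep_le_cast v
  have hu1 := congrArg Prod.fst hu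
  have hu2 := congrArg Prod.snd hu
  have hv1 := congrArg Prod.fst hv
  have hv2 := congrArg Prod.snd hv
  simp only at hu1 hu2 hv1 hv2
  have hW : (0 : ℝ) < W := by linarith
  rcases eq_or_adjacent_of_quadrants (L.ray_lt u) (L.ray_lt v)
      (ne_centre (r := ray u) (Or.inl (by rw [hu1]; linarith)))
      (by rw [hu1]; linarith) (by rw [hu2]; linarith) (by rw [hv1]; linarith)
      (by rw [hv2]; linarith) with h' | ⟨_, h', _⟩ | ⟨_, h', _⟩
  · rw [h'] at hu1 hu2 hv1 hv2
    have e2 : (dep u : ℝ) = dep v := by linarith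
    have e1 : (idx u : ℝ) = idx v := by linarith
    exact L.idx_inj (L.bucket_eq h h') (by exact_mod_cast e1)
  · linarith
  · linarith

/-- Points of an edge in the frame of the ray of its parent. -/
theorem edge_param (L : IsLayout W child bucket idx dep ray) {p c : V} (hpc : child p c)
    (h : Near bucket p c) {z : ℝ × ℝ}
    (hz : z ∈ segment ℝ (realPoint W (idx p) (dep p) (ray p))
      (realPoint W (idx c) (dep c) (ray c))) :
    ∃ t : ℝ, 0 ≤ t ∧ t ≤ 1 ∧ (t = 0 → z = realPoint W (idx p) (dep p) (ray p)) ∧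
      (t = 1 → z = realPoint W (idx c) (dep c) (ray c)) ∧
      ((bucket p = bucket c ∧
          (rayFrame W (ray p) z).1 =
            2 * W + 2 * (((idx p : ℝ) - dep p) + t * ((idx c : ℝ) - idx p - 1)) ∧
          (rayFrame W (ray p) z).2 = dep p + t) ∨
        (bucket p ≠ bucket c ∧
          (rayFrame W (ray p) z).1 = (1 - t) * (2 * W + 2 * ((idx p : ℝ) - dep p)) ∧
          (rayFrame W (ray p) z).2 = dep p + t * (2 * W + 2 * (idx c : ℝ) - dep p))) := by
  rw [segment_eq_image_lineMap] at hz
  obtain ⟨t, ⟨ht0, ht1⟩, rfl⟩ := hz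
  refine ⟨t, ht0, ht1, ?_, ?_, ?_⟩
  · rintro rfl; simp
  · rintro rfl; simp
  · rw [rayFrame_segment, L.frame_point p]
    by_cases hb : bucket p = bucket c
    · left
      rw [← L.in_ray hpc hb, L.frame_point c, L.in_dep hpc hb]
      refine ⟨hb, ?_, ?_⟩ <;> simp [AffineMap.lineMap_apply] <;> ring
    · right
      have hr : ray c = (ray p + 1) % 4 := L.out_ray hpc (by unfold Near at h; omega)
      have hc := L.frame_point c
      rw [hr, rayFrame_succ W (L.ray_lt p), ← hr, L.out_dep hpc hb] at hc
      have h1 := congrArg Prod.fst hc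
      have h2 := congrArg Prod.snd hc
      simp only [Nat.cast_zero, sub_zero, neg_eq_zero] at h1 h2
      rw [L.out_dep hpc hb]
      refine ⟨hb, ?_, ?_⟩ <;> simp [AffineMap.lineMap_apply, h1, h2] <;> ring

/-- This confines an edge to the quadrant that begins at the ray of its parent, with contact to the
two bounding rays only at end-vertices. It reduces crossings to edges with parents on one ray. -/
theorem edge_quadrant (L : IsLayout W child bucket idx dep ray) {p c : V} (hpc : child p c)
    (h : Near bucket p c) {z : ℝ × ℝ}
    (hz : z ∈ segment ℝ (realPoint W (idx p) (dep p) (ray p))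
      (realPoint W (idx c) (dep c) (ray c))) :
    z ≠ (4 * (W : ℝ), 4 * (W : ℝ)) ∧
    0 ≤ (rayFrame W (ray p) z).1 ∧ 0 ≤ (rayFrame W (ray p) z).2 ∧
      ((rayFrame W (ray p) z).1 = 0 → z = realPoint W (idx c) (dep c) (ray c)) ∧
      ((rayFrame W (ray p) z).2 = 0 → z = realPoint W (idx p) (dep p) (ray p)) := by
  obtain ⟨p0, p1, p2⟩ := L.dep_le_cast p
  obtain ⟨c0, c1, c2⟩ := L.dep_le_cast c
  obtain ⟨t, ht0, ht1, e0, e1, ⟨hb, hx, hy⟩ | ⟨hb, hx, hy⟩⟩ := L.edge_param hpc h hz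
  · have hi : (idx p : ℝ) + 1 ≤ idx c := by exact_mod_cast L.in_idx hpc hb
    have : 0 ≤ t * ((idx c : ℝ) - idx p - 1) := mul_nonneg ht0 (by linarith)
    refine ⟨ne_centre (r := ray p) (Or.inl (by rw [hx]; linarith)), by rw [hx]; linarith,
      by rw [hy]; linarith, fun h0 => ?_, fun h0 => e0 ?_⟩
    · rw [hx] at h0; linarith
    · linarith
  · have hA : 0 < 2 * W + 2 * ((idx p : ℝ) - dep p) := by linarith
    have hB : 0 < 2 * W + 2 * (idx c : ℝ) - dep p := by linarith
    have hA' := mul_nonneg (sub_nonneg.2 ht1) hA.le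
    have hB' := mul_nonneg ht0 hB.le
    have ex : (rayFrame W (ray p) z).1 = 0 → t = 1 := by
      intro h0
      rw [hx] at h0
      rcases mul_eq_zero.1 h0 with h1 | h1 <;> linarith
    have ey : (rayFrame W (ray p) z).2 = 0 → t = 0 := by
      intro h0
      rw [hy] at h0
      rcases mul_eq_zero.1 (by linarith : t * (2 * W + 2 * (idx c : ℝ) - dep p) = 0) with h1 | h1
      · exact h1
      · linarith
    refine ⟨ne_centre (r := ray p) ?_, by rw [hx]; exact hA', by rw [hy]; linarith,
      fun h0 => e1 (ex h0), fun h0 => e0 (ey h0)⟩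
    by_contra hcon
    rw [not_or, not_lt, not_lt] at hcon
    have h1 := ex (le_antisymm hcon.1 (by rw [hx]; exact hA'))
    have h2 := ey (le_antisymm hcon.2 (by rw [hy]; linarith))
    linarith

theorem point_quadrant (L : IsLayout W child bucket idx dep ray) (v : V) :
    0 < (rayFrame W (ray v) (realPoint W (idx v) (dep v) (ray v))).1 ∧
      0 ≤ (rayFrame W (ray v) (realPoint W (idx v) (dep v) (ray v))).2 := by
  obtain ⟨p0, p1, p2⟩ := L.dep_le_cast v
  rw [L.frame_point v]
  constructor <;> simp only <;> linarith

/-- A vertex is treated as the starting point of an imaginary leaving edge, so that the lemmas on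
pairs of edges apply. -/
theorem vertex_mem_edge (L : IsLayout W child bucket idx dep ray) {p c v : V} (hpc : child p c)
    (h : Near bucket p c) (hv : Near bucket p v) (hv' : Near bucket c v)
    (hz : realPoint W (idx v) (dep v) (ray v) ∈ segment ℝ (realPoint W (idx p) (dep p) (ray p))
      (realPoint W (idx c) (dep c) (ray c))) : v = p ∨ v = c := by
  obtain ⟨hne, q1, q2, q3, q4⟩ := L.edge_quadrant hpc h hz
  obtain ⟨r1, r2⟩ := L.point_quadrant v
  rcases eq_or_adjacent_of_quadrants (L.ray_lt p) (L.ray_lt v) hne q1 q2 r1.le r2 with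
    hr | ⟨_, h0, _⟩ | ⟨_, h0, _⟩
  · have hbv := L.bucket_eq hv hr
    obtain ⟨p0, p1, p2⟩ := L.dep_le_cast p
    obtain ⟨v0, v1, v2⟩ := L.dep_le_cast v
    obtain ⟨c0, c1, c2⟩ := L.dep_le_cast c
    obtain ⟨t, ht0, ht1, e0, e1, ⟨hb, hx, hy⟩ | ⟨hb, hx, hy⟩⟩ := L.edge_param hpc h hz
    · rw [hr, L.frame_point v] at hx hy
      simp only at hx hy
      have hi := L.in_idx hpc hb
      -- The imaginary edge from `v` has parameter `s = 0`; its target rank `j = 0` is arbitrary.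
      have key := inEdge_outEdge_meet (W := W) (i := idx p) (d := dep p) (c := idx c) (t := t)
        (k := idx v) (e := dep v) (j := 0) (s := 0) (by exact_mod_cast hi) v2 v1 v0 le_rfl le_rfl
        ht0 ht1
        (fun hk => by
          have := L.dep_le hbv.symm (by exact_mod_cast hk)
          have : (dep p : ℝ) + idx v ≤ dep v + idx p := by exact_mod_cast this
          linarith)
        (fun hk => by
          have hk' : idx v ≤ idx p := by exact_mod_cast hk
          have := L.dep_le (hbv.symm.trans hb) (by omega)
          rw [L.in_dep hpc hb] at this
          have : (dep p : ℝ) + 1 + idx v ≤ dep v + idx c := by exact_mod_cast this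
          linarith)
        (fun h1 h2 => by
          have := L.in_between hpc hb hbv.symm (by exact_mod_cast h1)
            (by exact_mod_cast h2.le)
          rw [L.in_dep hpc hb] at this
          exact_mod_cast this)
        (by linarith) (by linarith)
      rcases key with ⟨_, hk⟩ | ⟨_, hk⟩
      · left; exact L.idx_inj hbv.symm (by exact_mod_cast hk)
      · right; exact L.idx_inj (hbv.symm.trans hb) (by exact_mod_cast hk)
    · rw [hr, L.frame_point v] at hx hy
      simp only at hx hy
      left
      rcases le_or_gt (idx p) (idx v) with hk | hk
      · have hd := L.dep_le hbv hk
        have hd' : (dep v : ℝ) + idx p ≤ dep p + idx v := by exact_mod_cast hd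
        -- Again `v` is the point with parameter `0` of an imaginary edge; the target `idx c + 1`
        -- only has to exceed `idx c`.
        have := outEdges_meet (W := W) (i := idx p) (d := dep p) (j := idx c) (t := t)
          (i' := idx v) (d' := dep v) (j' := idx c + 1) (t' := 0) p1 p2 p0 (Nat.cast_nonneg _)
          le_rfl zero_le_one (by exact_mod_cast hk) (by linarith) (by linarith)
          (by linarith) (by linarith)
        exact (L.idx_inj hbv (by exact_mod_cast this.2)).symm
      · exfalso
        have hk' : (idx v : ℝ) < idx p := by exact_mod_cast hk
        -- The coordinate `x/2 + y - W` starts at `idx p` and does not decrease along the edge, so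
        -- it misses the smaller rank of `v`.
        have : 0 ≤ t * (W + 2 * (idx c : ℝ) - idx p) := mul_nonneg ht0 (by linarith)
        linarith
  · exact Or.inr (L.point_inj ⟨hv'.2, hv'.1⟩ (q3 h0))
  · linarith

/-- The disjunction covers siblings as well as different parents: in both cases the children are
strictly ordered, as `outEdges_meet` needs. -/
theorem edges_meet_of_idx_le (L : IsLayout W child bucket idx dep ray) {p c p' c' : V}
    (hpc : child p c) (hpc' : child p' c') (hb : bucket p ≠ bucket c) (hb' : bucket p' ≠ bucket c')
    (hpp : bucket p = bucket p') (hcc : bucket c = bucket c')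
    (hlt : idx p < idx p' ∨ p = p' ∧ idx c < idx c') {t t' : ℝ} (ht0 : 0 ≤ t') (ht1 : t' ≤ 1)
    (hx : (1 - t) * (2 * W + 2 * ((idx p : ℝ) - dep p)) =
      (1 - t') * (2 * W + 2 * ((idx p' : ℝ) - dep p')))
    (hy : dep p + t * (2 * W + 2 * (idx c : ℝ) - dep p) =
      dep p' + t' * (2 * W + 2 * (idx c' : ℝ) - dep p')) : p = p' ∧ t' = 0 := by
  obtain ⟨p0, p1, p2⟩ := L.dep_le_cast p
  have hle : idx p ≤ idx p' := by
    rcases hlt with h | ⟨rfl, _⟩ <;> omega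
  have hd : (dep p' : ℝ) + idx p ≤ dep p + idx p' := by exact_mod_cast L.dep_le hpp hle
  have hj : idx c < idx c' := by
    rcases hlt with h | ⟨_, h⟩
    · exact L.out_idx hpc hpc' hpp hcc hb h
    · exact h
  have := outEdges_meet p1 p2 p0 (Nat.cast_nonneg _) ht0 ht1 (by exact_mod_cast hle)
    (by linarith) (by exact_mod_cast hj) hx hy
  exact ⟨L.idx_inj hpp (by exact_mod_cast this.2), this.1⟩

theorem in_out_meet (L : IsLayout W child bucket idx dep ray) {p c p' c' : V}
    (hpc : child p c) (hb : bucket p = bucket c)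
    (hpp : bucket p = bucket p') {t t' : ℝ} (h0 : 0 ≤ t) (h1 : t ≤ 1)
    (ht0 : 0 ≤ t')
    (hx : 2 * W + 2 * (((idx p : ℝ) - dep p) + t * ((idx c : ℝ) - idx p - 1)) =
      (1 - t') * (2 * W + 2 * ((idx p' : ℝ) - dep p')))
    (hy : dep p + t =
      dep p' + t' * (2 * W + 2 * (idx c' : ℝ) - dep p')) :
    (t = 0 ∧ p' = p) ∨ (t = 1 ∧ p' = c) := by
  obtain ⟨v0, v1, v2⟩ := L.dep_le_cast p'
  have hi := L.in_idx hpc hb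
  have key := inEdge_outEdge_meet (W := W) (i := idx p) (d := dep p) (c := idx c) (t := t)
    (k := idx p') (e := dep p') (j := idx c') (s := t') (by exact_mod_cast hi) v2 v1 v0
    (Nat.cast_nonneg _) ht0 h0 h1
    (fun hk => by
      have := L.dep_le hpp.symm (by exact_mod_cast hk)
      have : (dep p : ℝ) + idx p' ≤ dep p' + idx p := by exact_mod_cast this
      linarith)
    (fun hk => by
      have hk' : idx p' ≤ idx p := by exact_mod_cast hk
      have := L.dep_le (hpp.symm.trans hb) (by omega)
      rw [L.in_dep hpc hb] at this
      have : (dep p : ℝ) + 1 + idx p' ≤ dep p' + idx c := by exact_mod_cast this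
      linarith)
    (fun h1 h2 => by
      have := L.in_between hpc hb hpp.symm (by exact_mod_cast h1)
        (by exact_mod_cast h2.le)
      rw [L.in_dep hpc hb] at this
      exact_mod_cast this)
    hx hy
  rcases key with ⟨h, hk⟩ | ⟨h, hk⟩
  · exact Or.inl ⟨h, L.idx_inj hpp.symm (by exact_mod_cast hk)⟩
  · exact Or.inr ⟨h, L.idx_inj (hpp.symm.trans hb) (by exact_mod_cast hk)⟩

/-- With parents on different rays, a common point lies on the ray shared by the two quadrants,
where it is the child of one edge and the parent of the other. With parents on the same ray, the
buckets agree and the three comparisons inside one frame apply. -/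
theorem edges_meet (L : IsLayout W child bucket idx dep ray) {p c p' c' : V}
    (hpc : child p c) (hpc' : child p' c') (h : Near bucket p c) (h' : Near bucket p' c')
    (hpp : Near bucket p p') (hcc : Near bucket c c') (hpc2 : Near bucket p c')
    (hcp : Near bucket c p') (hne : ¬ (p = p' ∧ c = c')) {z : ℝ × ℝ}
    (hz : z ∈ segment ℝ (realPoint W (idx p) (dep p) (ray p))
      (realPoint W (idx c) (dep c) (ray c)))
    (hz' : z ∈ segment ℝ (realPoint W (idx p') (dep p') (ray p'))
      (realPoint W (idx c') (dep c') (ray c'))) :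
    ∃ v, (v = p ∨ v = c) ∧ (v = p' ∨ v = c') ∧ z = realPoint W (idx v) (dep v) (ray v) := by
  obtain ⟨hne1, q1, q2, q3, q4⟩ := L.edge_quadrant hpc h hz
  obtain ⟨-, q1', q2', q3', q4'⟩ := L.edge_quadrant hpc' h' hz'
  have hcne : c ≠ c' := by
    rintro rfl
    exact hne ⟨L.child_unique hpc hpc', rfl⟩
  rcases eq_or_adjacent_of_quadrants (L.ray_lt p) (L.ray_lt p') hne1 q1 q2 q1' q2' with
    hr | ⟨_, h0, h0'⟩ | ⟨_, h0, h0'⟩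
  · have hb2 := L.bucket_eq hpp hr
    obtain ⟨t, ht0, ht1, e0, e1, ⟨hb, hx, hy⟩ | ⟨hb, hx, hy⟩⟩ := L.edge_param hpc h hz <;>
    obtain ⟨t', ht0', ht1', e0', e1', ⟨hb', hx', hy'⟩ | ⟨hb', hx', hy'⟩⟩ :=
      L.edge_param hpc' h' hz' <;>
    rw [hr, hx'] at hx <;> rw [hr, hy'] at hy
    -- Between a parent and its child the preorder lists only vertices at least as deep as the
    -- child, so a later vertex of the parent's depth comes after the child.
    · have sep : ∀ {p c p' c' : V}, child p c → bucket p = bucket c → bucket p = bucket p' →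
          (dep p : ℝ) = dep p' → (idx p : ℝ) < idx p' → (idx c : ℝ) < idx p' := by
        intro p c p' c' hpc hb hb2 hd hi
        by_contra hcon
        have := L.in_between hpc hb hb2.symm (by exact_mod_cast hi)
          (by exact_mod_cast (not_lt.1 hcon))
        rw [L.in_dep hpc hb] at this
        have hd' : dep p = dep p' := by exact_mod_cast hd
        omega
      have key := inEdges_meet (W := W) (by exact_mod_cast L.in_idx hpc hb)
        (by exact_mod_cast L.in_idx hpc' hb') ht0 ht1 ht0' ht1'
        (by
          rcases lt_trichotomy (dep p) (dep p') with h | h | h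
          · right; left; exact_mod_cast h
          · left; exact_mod_cast h
          · right; right; exact_mod_cast h)
        (fun hd => sep (c' := c') hpc hb hb2 hd)
        (fun hd => sep (c' := c) hpc' hb' hb2.symm hd.symm) hx.symm hy.symm
      rcases key with ⟨h1, h2, h3⟩ | ⟨h1, h2, h3⟩ | ⟨h1, h2, h3⟩ | ⟨h1, h2⟩
      · exact ⟨c, Or.inr rfl, Or.inl (L.idx_inj (hb.symm.trans hb2) (by exact_mod_cast h3)), e1 h1⟩
      · exact ⟨p, Or.inl rfl, Or.inr (L.idx_inj (hb2.trans hb') (by exact_mod_cast h3)), e0 h1⟩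
      · exact ⟨p, Or.inl rfl, Or.inl (L.idx_inj hb2 (by exact_mod_cast h3)), e0 h1⟩
      · exact absurd (L.idx_inj (hb.symm.trans (hb2.trans hb')) (by exact_mod_cast h2)) hcne
    · rcases L.in_out_meet hpc hb hb2 ht0 ht1 ht0' hx.symm hy.symm with ⟨h1, h2⟩ | ⟨h1, h2⟩
      · exact ⟨p, Or.inl rfl, Or.inl h2.symm, e0 h1⟩
      · exact ⟨c, Or.inr rfl, Or.inl h2.symm, e1 h1⟩
    · rcases L.in_out_meet hpc' hb' hb2.symm ht0' ht1' ht0 hx hy with ⟨h1, h2⟩ | ⟨h1, h2⟩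
      · exact ⟨p', Or.inl h2.symm, Or.inl rfl, e0' h1⟩
      · exact ⟨c', Or.inl h2.symm, Or.inr rfl, e1' h1⟩
    -- Both children are on the ray after the common one, so the parity argument applies to them
    -- too.
    · have hcc' : bucket c = bucket c' := by
        apply L.bucket_eq hcc
        rw [L.out_ray hpc (by unfold Near at h; omega),
          L.out_ray hpc' (by unfold Near at h'; omega), hr]
      rcases lt_trichotomy (idx p) (idx p') with hi | hi | hi
      · obtain ⟨rfl, ht⟩ := L.edges_meet_of_idx_le hpc hpc' hb hb' hb2 hcc' (Or.inl hi)
          ht0' ht1' hx.symm hy.symm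
        exact ⟨p, Or.inl rfl, Or.inl rfl, e0' ht⟩
      · obtain rfl := L.idx_inj hb2 hi
        rcases lt_trichotomy (idx c) (idx c') with hj | hj | hj
        · obtain ⟨_, ht⟩ := L.edges_meet_of_idx_le hpc hpc' hb hb' hb2 hcc'
            (Or.inr ⟨rfl, hj⟩) ht0' ht1' hx.symm hy.symm
          exact ⟨p, Or.inl rfl, Or.inl rfl, e0' ht⟩
        · exact absurd (L.idx_inj hcc' hj) hcne
        · obtain ⟨_, ht⟩ := L.edges_meet_of_idx_le hpc' hpc hb' hb hb2 hcc'.symm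
            (Or.inr ⟨rfl, hj⟩) ht0 ht1 hx hy
          exact ⟨p, Or.inl rfl, Or.inl rfl, e0 ht⟩
      · obtain ⟨rfl, ht⟩ := L.edges_meet_of_idx_le hpc' hpc hb' hb hb2.symm hcc'.symm
          (Or.inl hi) ht0 ht1 hx hy
        exact ⟨p', Or.inl rfl, Or.inl rfl, e0 ht⟩
  · have e := q3 h0
    have e' := q4' h0'
    have := L.point_inj hcp (e.symm.trans e')
    exact ⟨c, Or.inr rfl, Or.inl this, e⟩
  · have e := q3' h0
    have e' := q4 h0'
    have := L.point_inj hpc2 (e'.symm.trans e)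
    exact ⟨p, Or.inl rfl, Or.inr this, e'⟩

end IsLayout
end StoryDrawing

namespace StoryDrawing

/-! ### The drawing story of a layout -/

theorem isJordanArc_segment {p q : ℝ × ℝ} (h : p ≠ q) : IsJordanArc (segment ℝ p q) p q := by
  refine ⟨⟨⟨fun t => AffineMap.lineMap p q (t : ℝ), by fun_prop⟩, by simp, by simp⟩, ?_, ?_⟩
  · intro s t hst
    exact Subtype.ext (AffineMap.lineMap_injective ℝ h hst)
  · rw [segment_eq_image_lineMap]
    ext z
    simp [unitInterval]

/-- The segment between the images of the two end-vertices of a potential edge. -/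
def segmentArc {V : Type*} (pt : V → ℝ × ℝ) : Sym2 V → Set (ℝ × ℝ) :=
  Sym2.lift ⟨fun u v => segment ℝ (pt u) (pt v), fun u v => segment_symm ℝ (pt u) (pt v)⟩

namespace GraphStory

variable {V : Type*} [Fintype V]

/-- The times are cut into buckets of `window` consecutive times each. -/
def bucket (S : GraphStory V) (v : V) : ℕ := (S.time v - 1) / S.window

theorem mem_snapshot {S : GraphStory V} {t : ℕ} {v : V} :
    v ∈ (S.snapshot t).verts ↔ t < S.time v + S.window ∧ S.time v ≤ t := Iff.rfl

theorem snapshot_adj {S : GraphStory V} {t : ℕ} {u v : V} :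
    (S.snapshot t).Adj u v ↔
      u ∈ (S.snapshot t).verts ∧ v ∈ (S.snapshot t).verts ∧ S.graph.Adj u v := Iff.rfl

theorem one_le_time (S : GraphStory V) (v : V) : 1 ≤ S.time v :=
  (S.time_bijOn.mapsTo (Set.mem_univ v)).1

theorem time_le (S : GraphStory V) (v : V) : S.time v ≤ Fintype.card V :=
  (S.time_bijOn.mapsTo (Set.mem_univ v)).2

/-- Times in one window differ by less than `window`, so their quotients differ by at most one. -/
theorem bucket_le {S : GraphStory V} {t : ℕ} {u v : V} (hu : u ∈ (S.snapshot t).verts)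
    (hv : v ∈ (S.snapshot t).verts) : S.bucket u ≤ S.bucket v + 1 := by
  rw [mem_snapshot] at hu hv
  unfold bucket
  have h := S.one_le_time v
  have h' := S.one_le_time u
  rw [← Nat.add_div_right _ S.window_pos]
  exact Nat.div_le_div_right (by omega)

theorem near_of_mem_snapshot {S : GraphStory V} {t : ℕ} {u v : V}
    (hu : u ∈ (S.snapshot t).verts) (hv : v ∈ (S.snapshot t).verts) :
    IsLayout.Near S.bucket u v :=
  ⟨bucket_le hu hv, bucket_le hv hu⟩

end GraphStory

variable {V : Type*} [Fintype V] {S : GraphStory V} {child : V → V → Prop}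
  {idx dep ray : V → ℕ}

/-- The straight-line drawing story given by a layout. -/
def layoutStory (L : IsLayout S.window child S.bucket idx dep ray) : DrawingStory S where
  drawing t :=
    { point := fun v => realPoint S.window (idx v) (dep v) (ray v)
      arc := segmentArc fun v => realPoint S.window (idx v) (dep v) (ray v)
      point_injOn := fun _ hu _ hv h => L.point_inj (GraphStory.near_of_mem_snapshot hu hv) h
      arc_joins := fun u v h => isJordanArc_segment fun h' => by
        rw [GraphStory.snapshot_adj] at h
        exact h.2.2.ne (L.point_inj (GraphStory.near_of_mem_snapshot h.1 h.2.1) h') }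
  point_eq _ _ _ _ _ := rfl
  arc_eq _ _ _ _ _ := rfl

theorem layoutStory_straightLine (L : IsLayout S.window child S.bucket idx dep ray) :
    (layoutStory L).StraightLine := fun _ _ _ _ => rfl

theorem layoutStory_planar (L : IsLayout S.window child S.bucket idx dep ray)
    (hadj : ∀ u v, S.graph.Adj u v → child u v ∨ child v u) : (layoutStory L).Planar := by
  intro t
  have orient : ∀ e ∈ (S.snapshot t).edgeSet, ∃ p c, e = s(p, c) ∧ child p c ∧
      p ∈ (S.snapshot t).verts ∧ c ∈ (S.snapshot t).verts := by
    intro e he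
    induction e using Sym2.ind with
    | _ u v =>
      rw [SimpleGraph.Subgraph.mem_edgeSet, GraphStory.snapshot_adj] at he
      rcases hadj u v he.2.2 with h | h
      · exact ⟨u, v, rfl, h, he.1, he.2.1⟩
      · exact ⟨v, u, Sym2.eq_swap, h, he.2.1, he.1⟩
  constructor
  · intro e he f hf hne x hx
    obtain ⟨p, c, rfl, hpc, hp, hc⟩ := orient e he
    obtain ⟨p', c', rfl, hpc', hp', hc'⟩ := orient f hf
    obtain ⟨v, h1, h2, h3⟩ := L.edges_meet hpc hpc' (GraphStory.near_of_mem_snapshot hp hc)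
      (GraphStory.near_of_mem_snapshot hp' hc') (GraphStory.near_of_mem_snapshot hp hp')
      (GraphStory.near_of_mem_snapshot hc hc') (GraphStory.near_of_mem_snapshot hp hc')
      (GraphStory.near_of_mem_snapshot hc hp')
      (fun h => hne (by rw [h.1, h.2])) hx.1 hx.2
    exact ⟨v, Sym2.mem_iff.2 h1, Sym2.mem_iff.2 h2, h3⟩
  · intro e he v hv hx
    obtain ⟨p, c, rfl, hpc, hp, hc⟩ := orient e he
    exact Sym2.mem_iff.2 (L.vertex_mem_edge hpc (GraphStory.near_of_mem_snapshot hp hc)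
      (GraphStory.near_of_mem_snapshot hp hv) (GraphStory.near_of_mem_snapshot hc hv) hx)

theorem layoutStory_liesOnGrid (L : IsLayout S.window child S.bucket idx dep ray) :
    (layoutStory L).LiesOnGridOfSize (8 * S.window + 1) (8 * S.window + 1) := by
  have hW := S.window_pos
  have mem : ∀ v, realPoint S.window (idx v) (dep v) (ray v) ∈
      Set.Icc ((0 : ℤ) : ℝ) ((8 * S.window : ℕ) : ℤ) ×ˢ
        Set.Icc ((0 : ℤ) : ℝ) ((8 * S.window : ℕ) : ℤ) := by
    intro v
    have h := gridPoint_le (r := ray v) (L.dep_le_idx v) (L.idx_lt v)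
    simp only [realPoint, Set.mem_prod, Set.mem_Icc, Int.cast_zero, Int.cast_natCast]
    exact ⟨⟨Nat.cast_nonneg _, by exact_mod_cast h.1⟩, ⟨Nat.cast_nonneg _, by exact_mod_cast h.2⟩⟩
  refine ⟨0, (8 * S.window : ℕ), 0, (8 * S.window : ℕ), by omega, by omega, by omega, by omega,
    fun t => ⟨fun v _ => ⟨_, _, rfl⟩, fun v _ => mem v, fun e he => ?_⟩⟩
  induction e using Sym2.ind with
  | _ u v =>
    exact ((convex_Icc _ _).prod (convex_Icc _ _)).segment_subset (mem u) (mem v)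

end StoryDrawing

namespace StoryDrawing

/-! ### The traversal -/

/-- A rooted tree with a partition of its vertices into buckets; `dep` is the depth inside the
connected component of the bucket. -/
structure IsBucketTree {V : Type*} (root : V) (par : V → V) (bucket dep : V → ℕ)
    (kids : V → List V) : Prop where
  mem_kids : ∀ {p w}, w ∈ kids p ↔ w ≠ root ∧ par w = p
  kids_nodup : ∀ p, (kids p).Nodup
  in_dep : ∀ {w}, w ≠ root → bucket (par w) = bucket w → dep w = dep (par w) + 1
  out_dep : ∀ {w}, w ≠ root → bucket (par w) ≠ bucket w → dep w = 0
  root_dep : dep root = 0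
  induct : ∀ P : V → Prop, P root → (∀ w, w ≠ root → P (par w) → P w) → ∀ w, P w

/-- The state of the traversal: the visited vertices in the order of their visits, the stack,
the queue and the ranks of the visited vertices. -/
structure Traversal (V : Type*) where
  vis : List V
  stk : List V
  que : List V
  idx : V → ℕ

namespace Traversal

variable {V : Type*} (root : V) (par : V → V) (bucket dep : V → ℕ)
  (kids : V → List V)

/-- The number of visited vertices of a bucket. -/
def count (st : Traversal V) (k : ℕ) : ℕ := st.vis.countP fun x => bucket x = k

/-- Visit `v`, given the stack and the queue after its removal. -/
def visit [DecidableEq V] (st : Traversal V) (v : V) (S Q : List V) : Traversal V where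
  vis := st.vis ++ [v]
  stk := ((kids v).filter fun w => bucket w = bucket v).reverse ++ S
  que := Q ++ (kids v).filter fun w => ¬ bucket w = bucket v
  idx := Function.update st.idx v (st.count bucket (bucket v))

/-- `v` is the next vertex to be visited; `S` and `Q` are the stack and the queue without it. -/
def Next (st : Traversal V) (v : V) (S Q : List V) : Prop :=
  (st.stk = v :: S ∧ st.que = Q) ∨ (st.stk = [] ∧ S = [] ∧ st.que = v :: Q)

/-- The root of a component of a bucket that is not the root of the tree. -/
def Out (c : V) : Prop := c ≠ root ∧ bucket (par c) ≠ bucket c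

/-- A vertex with its parent in the same bucket. -/
def In (c : V) : Prop := c ≠ root ∧ bucket (par c) = bucket c

/-- While the stack is nonempty, `last` names the latest visited vertex of the bucket in progress,
which bounds the depth of what comes next. The stack is sorted with the deepest vertices on top, so
`between_stk` anticipates `between` for vertices still waiting. In `fifo` the queue is appended to
the visited vertices because its order is the future order of visits of component roots. -/
structure Inv (st : Traversal V) : Prop where
  nodup : (st.vis ++ (st.stk ++ st.que)).Nodup
  mem : ∀ w, w ∈ st.vis ∨ w ∈ st.stk ∨ w ∈ st.que ↔ w = root ∨ w ≠ root ∧ par w ∈ st.vis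
  stk_in : ∀ w ∈ st.stk, In root par bucket w
  que_out : ∀ w ∈ st.que, w = root ∨ Out root par bucket w
  last : st.stk = [] ∨ ∃ l ∈ st.vis, st.idx l + 1 = st.count bucket (bucket l) ∧
    ∀ w ∈ st.stk, bucket w = bucket l ∧ dep w ≤ dep l + 1
  stk_sorted : st.stk.Pairwise fun x y => dep y ≤ dep x
  idx_lt : ∀ x ∈ st.vis, st.idx x < st.count bucket (bucket x)
  dep_le : ∀ x ∈ st.vis, ∀ y ∈ st.vis, bucket x = bucket y → st.idx x ≤ st.idx y →
    dep y + st.idx x ≤ dep x + st.idx y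
  dep_le_idx : ∀ x ∈ st.vis, dep x ≤ st.idx x
  in_idx : ∀ c ∈ st.vis, In root par bucket c → st.idx (par c) < st.idx c
  between : ∀ c ∈ st.vis, In root par bucket c → ∀ k ∈ st.vis, bucket k = bucket c →
    st.idx (par c) < st.idx k → st.idx k ≤ st.idx c → dep c ≤ dep k
  between_stk : ∀ c ∈ st.stk, ∀ k ∈ st.vis, bucket k = bucket c → st.idx (par c) < st.idx k →
    dep c ≤ dep k
  fifo : (st.vis ++ st.que).Pairwise fun c c' => Out root par bucket c → Out root par bucket c' →
    bucket (par c) = bucket (par c') → st.idx (par c) ≤ st.idx (par c')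
  order : st.vis.Pairwise fun x y => bucket x = bucket y → st.idx x < st.idx y

variable {root par bucket dep kids}

theorem inv_init (idx : V → ℕ) :
    Inv root par bucket dep ⟨[], [], [root], idx⟩ := by
  constructor <;> simp [eq_comm]

/-- A vertex from the stack is at most one deeper than the latest vertex of its bucket; a vertex
from the queue has depth `0`. So the next rank keeps the growth of depth at most one per rank. -/
theorem next_dep_le {st : Traversal V} (T : IsBucketTree root par bucket dep kids)
    (h : Inv root par bucket dep st) {v : V} {S Q : List V} (hn : st.Next v S Q) :
    dep v ≤ st.count bucket (bucket v) ∧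
    ∀ x ∈ st.vis, bucket x = bucket v →
      dep v + st.idx x ≤ dep x + st.count bucket (bucket v) := by
  rcases hn with ⟨h1, h2⟩ | ⟨h1, h2, h3⟩
  · rcases h.last with h0 | ⟨l, hl, hl1, hl2⟩
    · rw [h1] at h0; cases h0
    · obtain ⟨hb, hd⟩ := hl2 v (by simp [h1])
      rw [hb]
      refine ⟨by have := h.dep_le_idx l hl; omega, fun x hx hxb => ?_⟩
      have h4 := h.idx_lt x hx
      rw [hxb] at h4
      have := h.dep_le x hx l hl hxb (by omega)
      omega
  · have hd : dep v = 0 := by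
      rcases h.que_out v (by simp [h3]) with rfl | h4
      · exact T.root_dep
      · exact T.out_dep h4.1 h4.2
    rw [hd]
    refine ⟨Nat.zero_le _, fun x hx hxb => ?_⟩
    have h4 := h.idx_lt x hx
    rw [hxb] at h4
    omega

theorem visit_mem_aux {a b s q r p k e c : Prop} (h1 : a ∨ b ∨ s ∨ q ↔ r ∨ ¬r ∧ p)
    (h2 : k ↔ ¬r ∧ e) :
    (a ∨ b) ∨ (k ∧ c ∨ s) ∨ (q ∨ k ∧ ¬c) ↔ r ∨ ¬r ∧ (p ∨ e) := by
  grind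

set_option maxHeartbeats 2000000 in
-- The visited vertex receives the largest rank in its bucket, and its children are new. Depth-first
-- order controls the part inside the bucket, first-in-first-out order the component roots.
theorem inv_visit [DecidableEq V] {st : Traversal V} (T : IsBucketTree root par bucket dep kids)
    (h : Inv root par bucket dep st) {v : V} {S Q : List V} (hn : st.Next v S Q) :
    Inv root par bucket dep (st.visit bucket kids v S Q) := by
  have hmemv : v ∈ st.stk ∨ v ∈ st.que := by
    rcases hn with ⟨h1, h2⟩ | ⟨h1, h2, h3⟩
    · left; simp [h1]
    · right; simp [h3]
  have hvv : v ∉ st.vis := by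
    intro hv
    have := (List.nodup_append.1 h.nodup).2.2 v hv v (by simpa using hmemv)
    exact this rfl
  have hnd : (st.vis ++ (v :: (S ++ Q))).Nodup := by
    have := h.nodup
    rcases hn with ⟨h1, h2⟩ | ⟨h1, h2, h3⟩
    · simpa [h1, h2] using this
    · simpa [h1, h2, h3] using this
  have hmem : ∀ w, w ∈ st.vis ∨ w ∈ st.stk ∨ w ∈ st.que ↔ w ∈ st.vis ∨ w = v ∨ w ∈ S ∨ w ∈ Q := by
    intro w
    rcases hn with ⟨h1, h2⟩ | ⟨h1, h2, h3⟩
    · simp [h1, h2, or_assoc]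
    · simp [h1, h2, h3]
  have hS : ∀ w ∈ S, w ∈ st.stk := by
    intro w hw
    rcases hn with ⟨h1, h2⟩ | ⟨h1, h2, h3⟩
    · simp [h1, hw]
    · simp [h2] at hw
  have hQ : ∀ w ∈ Q, w ∈ st.que := by
    intro w hw
    rcases hn with ⟨h1, h2⟩ | ⟨h1, h2, h3⟩
    · simpa [h2] using hw
    · simp [h3, hw]
  obtain ⟨hdv, hdx⟩ := next_dep_le T h hn
  set st' := st.visit bucket kids v S Q with hst'
  have hvis : ∀ w, w ∈ st'.vis ↔ w ∈ st.vis ∨ w = v := by intro w; simp [hst', visit]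
  have hstk : ∀ w, w ∈ st'.stk ↔ (w ∈ kids v ∧ bucket w = bucket v) ∨ w ∈ S := by
    intro w; simp [hst', visit]
  have hque : ∀ w, w ∈ st'.que ↔ w ∈ Q ∨ (w ∈ kids v ∧ ¬ bucket w = bucket v) := by
    intro w; simp [hst', visit]
  have idv : st'.idx v = st.count bucket (bucket v) := by simp [hst', visit]
  have idx_of : ∀ x ∈ st.vis, st'.idx x = st.idx x := by
    intro x hx
    have : x ≠ v := by rintro rfl; exact hvv hx
    simp [hst', visit, this]
  have cnt : ∀ k, st'.count bucket k = st.count bucket k + if bucket v = k then 1 else 0 := by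
    intro k
    simp [hst', visit, count, List.countP_append, List.countP_cons]
  have hpar : ∀ w, w ∈ st.vis ∨ w ∈ st.stk ∨ w ∈ st.que → w ≠ root → par w ∈ st.vis := by
    intro w hw hr
    exact (((h.mem w).1 hw).resolve_left hr).2
  have hkid : ∀ w ∈ kids v, w ∉ st.vis ∧ w ∉ st.stk ∧ w ∉ st.que := by
    intro w hw
    obtain ⟨h1, h2⟩ := T.mem_kids.1 hw
    have h3 : ¬ (w ∈ st.vis ∨ w ∈ st.stk ∨ w ∈ st.que) := fun h4 => hvv (h2 ▸ hpar w h4 h1)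
    rwa [not_or, not_or] at h3
  have hkv : ∀ w ∈ kids v, w ≠ v := by
    intro w hw hwv
    have := hkid w hw
    rw [hwv] at this
    exact hmemv.elim this.2.1 this.2.2
  have idx_last : ∀ x ∈ st.vis, bucket x = bucket v → st'.idx x < st'.idx v := by
    intro x hx hb
    rw [idx_of x hx, idv, ← hb]
    exact h.idx_lt x hx
  constructor
  · rw [List.nodup_append, List.nodup_cons, List.nodup_append] at hnd
    have k1 := T.kids_nodup v
    simp only [hst', visit, List.nodup_append, List.nodup_reverse, List.mem_append, List.mem_filter,
      List.mem_reverse, List.mem_singleton, List.nodup_singleton, k1.filter]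
    have hk := hkid
    have hk2 := hkv
    simp only [List.mem_append] at hnd
    obtain ⟨n1, ⟨n2, n3, n4, n5⟩, n6⟩ := hnd
    refine ⟨⟨n1, trivial, ?_⟩, ⟨⟨trivial, n3, ?_⟩, ⟨n4, trivial, ?_⟩, ?_⟩, ?_⟩
    · rintro a ha b rfl rfl; exact hvv ha
    · rintro a ⟨ha, -⟩ b hb rfl; exact (hk a ha).2.1 (hS a hb)
    · rintro a ha b ⟨hb, -⟩ rfl; exact (hk a hb).2.2 (hQ a ha)
    · rintro a (⟨ha, ha'⟩ | ha) b (hb | ⟨hb, hb'⟩) rfl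
      · exact (hk a ha).2.2 (hQ a hb)
      · simp_all
      · exact n5 a ha a hb rfl
      · exact (hk a hb).2.1 (hS a ha)
    · rintro a ha b hb rfl
      have : a ∈ kids v ∨ a ∈ S ∨ a ∈ Q := by
        rcases hb with (hb | hb) | hb | hb
        exacts [Or.inl hb.1, Or.inr (Or.inl hb), Or.inr (Or.inr hb), Or.inl hb.1]
      rcases ha with ha | rfl
      · rcases this with h | h
        · exact (hk a h).1 ha
        · exact n6 a ha a (by simp [h]) rfl
      · rcases this with h | h
        · exact hk2 a h rfl
        · exact n2 h
  · intro w
    have h1 := h.mem w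
    rw [hmem w] at h1
    rw [hvis, hstk, hque, hvis]
    have h2 : w ∈ kids v ↔ _ := T.mem_kids
    exact visit_mem_aux h1 h2
  · intro w hw
    rcases (hstk w).1 hw with ⟨h1, h2⟩ | h1
    · obtain ⟨h3, h4⟩ := T.mem_kids.1 h1
      exact ⟨h3, by rw [h4, h2]⟩
    · exact h.stk_in w (hS w h1)
  · intro w hw
    rcases (hque w).1 hw with h1 | ⟨h1, h2⟩
    · exact h.que_out w (hQ w h1)
    · obtain ⟨h3, h4⟩ := T.mem_kids.1 h1
      exact Or.inr ⟨h3, by rw [h4]; exact fun h => h2 h.symm⟩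
  · right
    refine ⟨v, (hvis v).2 (Or.inr rfl), by rw [idv, cnt]; simp, fun w hw => ?_⟩
    rcases (hstk w).1 hw with ⟨h1, h2⟩ | h1
    · obtain ⟨h3, h4⟩ := T.mem_kids.1 h1
      exact ⟨h2, by rw [T.in_dep h3 (by rw [h4, h2]), h4]⟩
    · rcases hn with ⟨h3, h4⟩ | ⟨h3, h4, h5⟩
      · rcases h.last with h0 | ⟨l, hl, hl1, hl2⟩
        · rw [h3] at h0; cases h0
        · have h6 := hl2 v (by simp [h3])
          have h7 := hl2 w (by simp [h3, h1])
          have h8 := h.stk_sorted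
          rw [h3, List.pairwise_cons] at h8
          exact ⟨h7.1.trans h6.1.symm, (h8.1 w h1).trans (Nat.le_succ _)⟩
      · simp [h4] at h1
  · have hin : ∀ x ∈ ((kids v).filter fun w => bucket w = bucket v).reverse,
        dep x = dep v + 1 := by
      intro x hx
      simp only [List.mem_reverse, List.mem_filter, decide_eq_true_eq] at hx
      obtain ⟨h3, h4⟩ := T.mem_kids.1 hx.1
      rw [T.in_dep h3 (by rw [h4, hx.2]), h4]
    show List.Pairwise _ (_ ++ S)
    rw [List.pairwise_append]
    have hSv : S.Pairwise (fun x y => dep y ≤ dep x) ∧ ∀ w ∈ S, dep w ≤ dep v := by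
      rcases hn with ⟨h3, h4⟩ | ⟨h3, h4, h5⟩
      · have h8 := h.stk_sorted
        rw [h3, List.pairwise_cons] at h8
        exact ⟨h8.2, h8.1⟩
      · simp [h4]
    refine ⟨?_, hSv.1, fun a ha b hb => ?_⟩
    · apply List.Pairwise.imp_of_mem (R := fun _ _ => True)
      · intro a b ha hb _; rw [hin a ha, hin b hb]
      · exact List.pairwise_of_forall fun _ _ => trivial
    · have := hSv.2 b hb
      rw [hin a ha]; omega
  · intro x hx
    rw [cnt]
    rcases (hvis x).1 hx with h1 | rfl
    · rw [idx_of x h1]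
      have := h.idx_lt x h1
      omega
    · rw [idv]; simp
  · intro x hx y hy hb hle
    rcases (hvis x).1 hx with h1 | rfl <;> rcases (hvis y).1 hy with h2 | rfl
    · rw [idx_of x h1, idx_of y h2] at *
      exact h.dep_le x h1 y h2 hb hle
    · rw [idx_of x h1, idv]
      exact hdx x h1 hb
    · have := idx_last y h2 hb.symm
      omega
    · omega
  · intro x hx
    rcases (hvis x).1 hx with h1 | rfl
    · rw [idx_of x h1]
      exact h.dep_le_idx x h1
    · rw [idv]; exact hdv
  · intro c hc hin
    rcases (hvis c).1 hc with h1 | rfl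
    · rw [idx_of c h1, idx_of _ (hpar c (Or.inl h1) hin.1)]
      exact h.in_idx c h1 hin
    · exact idx_last _ (hpar c (Or.inr hmemv) hin.1) hin.2
  · intro c hc hin k hk hb hlt hle
    rcases (hvis c).1 hc with h1 | rfl
    · have hp := hpar c (Or.inl h1) hin.1
      rw [idx_of _ hp] at hlt
      rw [idx_of c h1] at hle
      rcases (hvis k).1 hk with h2 | rfl
      · rw [idx_of k h2] at hlt hle
        exact h.between c h1 hin k h2 hb hlt hle
      · have := idx_last c h1 hb.symm
        rw [idx_of c h1] at this
        omega
    · rcases (hvis k).1 hk with h2 | rfl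
      · have hp := hpar c (Or.inr hmemv) hin.1
        rw [idx_of _ hp, idx_of k h2] at hlt
        -- A vertex with its parent in the same bucket cannot come from the queue, so the stack
        -- invariant for it becomes the invariant for visited vertices.
        have hcs : c ∈ st.stk := by
          rcases hmemv with h3 | h3
          · exact h3
          · rcases h.que_out c h3 with h4 | h4
            · exact absurd h4 hin.1
            · exact absurd hin.2 h4.2
        exact h.between_stk c hcs k h2 hb hlt
      · exact le_rfl
  -- For a fresh child of `v`, no visited vertex of the bucket ranks above `v`. For an older stack
  -- entry the only new vertex is `v`, which was on top and hence at least as deep.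
  · intro c hc k hk hb hlt
    rcases (hstk c).1 hc with ⟨h1, h2⟩ | h1
    · obtain ⟨h3, h4⟩ := T.mem_kids.1 h1
      rw [h4] at hlt
      rcases (hvis k).1 hk with h5 | rfl
      · have := idx_last k h5 (hb.trans h2)
        omega
      · omega
    · have h3 := h.stk_in c (hS c h1)
      have hp := hpar c (Or.inr (Or.inl (hS c h1))) h3.1
      rw [idx_of _ hp] at hlt
      rcases (hvis k).1 hk with h5 | rfl
      · rw [idx_of k h5] at hlt
        exact h.between_stk c (hS c h1) k h5 hb hlt
      · rcases hn with ⟨h6, h7⟩ | ⟨h6, h7, h8⟩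
        · have h8 := h.stk_sorted
          rw [h6, List.pairwise_cons] at h8
          exact h8.1 c h1
        · simp [h7] at h1
  · have hout : ∀ w ∈ (kids v).filter (fun w => ¬ bucket w = bucket v), par w = v := by
      intro w hw
      exact (T.mem_kids.1 (List.mem_filter.1 hw).1).2
    -- Moving `v` from the head of the queue leaves this concatenation unchanged. If `v` comes from
    -- the stack, it is not a component root of the relevant kind, and its insertion imposes
    -- nothing.
    have old : (st.vis ++ [v] ++ Q).Pairwise fun c c' => Out root par bucket c →
        Out root par bucket c' → bucket (par c) = bucket (par c') →
          st.idx (par c) ≤ st.idx (par c') := by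
      rcases hn with ⟨h6, h7⟩ | ⟨h6, h7, h8⟩
      · have hin := h.stk_in v (by simp [h6])
        have hno : ¬ Out root par bucket v := fun ho => ho.2 hin.2
        have hf := h.fifo
        rw [h7, List.pairwise_append] at hf
        rw [List.append_assoc, List.pairwise_append]
        refine ⟨hf.1, ?_, ?_⟩
        · rw [List.singleton_append, List.pairwise_cons]
          exact ⟨fun _ _ ho => absurd ho hno, hf.2.1⟩
        · intro a ha b hb
          rw [List.singleton_append, List.mem_cons] at hb
          rcases hb with rfl | hb
          · exact fun _ ho => absurd ho hno
          · exact hf.2.2 a ha b hb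
      · have hf := h.fifo
        rw [h8] at hf
        simpa using hf
    have hpar' : ∀ w ∈ st.vis ++ [v] ++ Q, w ≠ root → par w ∈ st.vis := by
      intro w hw hr
      refine hpar w ?_ hr
      simp only [List.mem_append, List.mem_singleton] at hw
      rcases hw with (hw | rfl) | hw
      · exact Or.inl hw
      · exact Or.inr hmemv
      · exact Or.inr (Or.inr (hQ w hw))
    show List.Pairwise _ (st.vis ++ [v] ++ (Q ++ (kids v).filter fun w => ¬ bucket w = bucket v))
    rw [← List.append_assoc, List.pairwise_append]
    refine ⟨?_, ?_, ?_⟩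
    · refine List.Pairwise.imp_of_mem ?_ old
      intro a b ha hb hab ho ho' hbb
      rw [idx_of _ (hpar' a ha ho.1), idx_of _ (hpar' b hb ho'.1)]
      exact hab ho ho' hbb
    · apply List.Pairwise.imp_of_mem (R := fun _ _ => True)
      · intro a b ha hb _ _ _ _; rw [hout a ha, hout b hb]
      · exact List.pairwise_of_forall fun _ _ => trivial
    -- The new queue entries have parent `v`, whose rank is the largest in its bucket so far.
    · intro a ha b hb ho _ hbb
      rw [hout b hb] at hbb ⊢
      exact (idx_last _ (hpar' a ha ho.1) hbb).le
  · show List.Pairwise _ (st.vis ++ [v])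
    rw [List.pairwise_append]
    refine ⟨?_, by simp, ?_⟩
    · refine List.Pairwise.imp_of_mem ?_ h.order
      intro a b ha hb hab hbb
      rw [idx_of a ha, idx_of b hb]
      exact hab hbb
    · intro a ha b hb hbb
      rw [List.mem_singleton] at hb
      subst hb
      exact idx_last a ha hbb

end Traversal
end StoryDrawing

/-! ### From a finished traversal to a layout -/

namespace StoryDrawing
namespace Traversal

variable {V : Type*} {root : V} {par : V → V} {bucket dep : V → ℕ} {kids : V → List V}

theorem Inv.all_visited {st : Traversal V} (T : IsBucketTree root par bucket dep kids)
    (h : Inv root par bucket dep st) (hS : st.stk = []) (hQ : st.que = []) (v : V) :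
    v ∈ st.vis := by
  have hm := h.mem
  simp only [hS, hQ, List.not_mem_nil, or_false] at hm
  exact T.induct (· ∈ st.vis) ((hm _).2 (Or.inl rfl))
    (fun w hw ih => (hm _).2 (Or.inr ⟨hw, ih⟩)) v

theorem rel_or_of_pairwise {α : Type*} {R : α → α → Prop} {l : List α} (h : l.Pairwise R)
    {a b : α} (ha : a ∈ l) (hb : b ∈ l) (hab : a ≠ b) : R a b ∨ R b a := by
  induction h with
  | nil => cases ha
  | cons hx _ ih =>
    rcases List.mem_cons.1 ha with rfl | ha'
    · rcases List.mem_cons.1 hb with rfl | hb'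
      · exact absurd rfl hab
      · exact Or.inl (hx _ hb')
    · rcases List.mem_cons.1 hb with rfl | hb'
      · exact Or.inr (hx _ ha')
      · exact ih ha' hb'

/-- The ray advances by the distance between the buckets, written with two truncated differences.
For adjacent buckets this is one turn; for distant ones, whose edges are never visible, it still
preserves the parity of ray plus bucket. -/
theorem Inv.isLayout {st : Traversal V} (T : IsBucketTree root par bucket dep kids)
    (h : Inv root par bucket dep st) (hS : st.stk = []) (hQ : st.que = []) {W : ℕ}
    (hW : ∀ k, st.count bucket k ≤ W) {ray : V → ℕ} (hroot : ray root < 4)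
    (hray : ∀ w, w ≠ root →
      ray w = (ray (par w) + ((bucket w - bucket (par w)) + (bucket (par w) - bucket w))) % 4) :
    IsLayout W (fun p c => c ≠ root ∧ par c = p) bucket st.idx dep ray := by
  have all := h.all_visited T hS hQ
  have inj : ∀ {u v}, bucket u = bucket v → st.idx u = st.idx v → u = v := by
    intro u v hb hi
    by_contra hne
    rcases rel_or_of_pairwise h.order (all u) (all v) hne with h1 | h1
    · have := h1 hb; omega
    · have := h1 hb.symm; omega
  have lt4 : ∀ v, ray v < 4 := by
    intro v
    by_cases hv : v = root
    · rwa [hv]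
    · rw [hray v hv]; omega
  refine
    { child_unique := ?_, idx_lt := ?_, idx_inj := inj, dep_le := ?_, dep_le_idx := ?_
      in_dep := ?_, in_ray := ?_, in_idx := ?_, in_between := ?_, out_dep := ?_, out_ray := ?_
      out_idx := ?_, ray_lt := lt4, ray_parity := ?_ }
  · rintro p p' c ⟨_, rfl⟩ ⟨_, rfl⟩; rfl
  · intro v; exact (h.idx_lt v (all v)).trans_le (hW _)
  · intro u v hb hi; exact h.dep_le u (all u) v (all v) hb hi
  · intro v; exact h.dep_le_idx v (all v)
  · rintro p c ⟨hc, rfl⟩ hb; exact T.in_dep hc hb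
  · rintro p c ⟨hc, rfl⟩ hb
    have := lt4 (par c)
    rw [hray c hc, hb]; omega
  · rintro p c ⟨hc, rfl⟩ hb; exact h.in_idx c (all c) ⟨hc, hb⟩
  · rintro p c k ⟨hc, rfl⟩ hb hk h1 h2
    exact h.between c (all c) ⟨hc, hb⟩ k (all k) (hk.trans hb) h1 h2
  · rintro p c ⟨hc, rfl⟩ hb; exact T.out_dep hc hb
  · rintro p c ⟨hc, rfl⟩ hb
    rw [hray c hc]; omega
  · rintro p c p' c' ⟨hc, rfl⟩ ⟨hc', rfl⟩ hp hcc hb hlt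
    -- If `c` did not have the smaller rank, then `c'` was visited before `c`, and the queue
    -- discipline would give `idx p' ≤ idx p`.
    by_contra hcon
    have hne : c ≠ c' := by rintro rfl; exact lt_irrefl _ hlt
    have hf := h.fifo
    rw [hQ, List.append_nil] at hf
    have ho : Out root par bucket c := ⟨hc, hb⟩
    have ho' : Out root par bucket c' := ⟨hc', by rw [← hp, ← hcc]; exact hb⟩
    rcases rel_or_of_pairwise (hf.and h.order) (all c) (all c') hne with h1 | h1
    · exact hcon (h1.2 hcc)
    · have := h1.1 ho' ho hp.symm
      omega
  · have key : ∀ v, (ray v + bucket v) % 2 = (ray root + bucket root) % 2 := by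
      refine T.induct _ rfl fun w hw ih => ?_
      rw [← ih, hray w hw]
      omega
    intro u v
    rw [key u, key v]

theorem Inv.count_le [Fintype V] [DecidableEq V] {st : Traversal V}
    (h : Inv root par bucket dep st) {W : ℕ}
    (hW : ∀ k, (Finset.univ.filter fun v => bucket v = k).card ≤ W) (k : ℕ) :
    st.count bucket k ≤ W := by
  refine le_trans ?_ (hW k)
  have hnd : (st.vis.filter fun x => bucket x = k).Nodup :=
    (List.nodup_append.1 h.nodup).1.filter _
  rw [count, List.countP_eq_length_filter, ← List.toFinset_card_of_nodup hnd]
  apply Finset.card_le_card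
  intro x hx
  simp only [List.mem_toFinset, List.mem_filter, decide_eq_true_eq] at hx
  simp [hx.2]

end Traversal

theorem GraphStory.card_bucket_le {V : Type*} [Fintype V] (S : GraphStory V) (k : ℕ) :
    (Finset.univ.filter fun v => S.bucket v = k).card ≤ S.window := by
  classical
  have : ((Finset.univ.filter fun v => S.bucket v = k).image S.time) ⊆
      Finset.Ico (k * S.window + 1) (k * S.window + S.window + 1) := by
    intro x hx
    simp only [Finset.mem_image, Finset.mem_filter, Finset.mem_univ, true_and] at hx
    obtain ⟨v, hv, rfl⟩ := hx
    have h1 := S.one_le_time v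
    unfold GraphStory.bucket at hv
    rw [Nat.div_eq_iff S.window_pos] at hv
    have := S.window_pos
    rw [Finset.mem_Ico]
    omega
  have h := Finset.card_le_card this
  rw [Finset.card_image_of_injOn] at h
  · simpa using h
  · intro u _ v _ huv
    exact S.time_bijOn.injOn (Set.mem_univ u) (Set.mem_univ v) huv

/-! ### Rooted trees -/

section Rooted

variable {V : Type*} {G : SimpleGraph V}

/-- A neighbour closer to the root is the penultimate vertex of a shortest path, and paths in a tree
are unique. -/
theorem existsUnique_parent (hG : G.IsTree) (r : V) {v : V} (hv : v ≠ r) :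
    ∃! p, G.Adj p v ∧ G.dist r v = G.dist r p + 1 := by
  have ext : ∀ p, G.Adj p v → G.dist r v = G.dist r p + 1 →
      ∃ q : G.Walk r v, q.IsPath ∧ q.penultimate = p := by
    intro p hp hd
    obtain ⟨q, hq⟩ := hG.connected.exists_walk_length_eq_dist r p
    refine ⟨q.concat hp, SimpleGraph.Walk.isPath_of_length_eq_dist _ ?_, by simp⟩
    rw [SimpleGraph.Walk.length_concat, hq, hd]
  obtain ⟨q, hq⟩ := hG.connected.exists_walk_length_eq_dist r v
  have hnil : ¬ q.Nil := fun h => hv h.eq.symm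
  refine ⟨q.penultimate, ⟨q.adj_penultimate hnil, ?_⟩, ?_⟩
  · rcases hG.dist_eq_dist_add_one_of_adj r (q.adj_penultimate hnil) with h | h
    · have h1 := SimpleGraph.dist_le q.dropLast
      have h2 : q.dropLast.length + 1 = q.length := by
        simpa using SimpleGraph.Walk.length_dropLast_add_one hnil
      omega
    · exact h
  · rintro p ⟨hp, hd⟩
    obtain ⟨q', hq', rfl⟩ := ext p hp hd
    have hqp : q.IsPath := q.isPath_of_length_eq_dist hq
    have : q = q' := congrArg Subtype.val
      ((hG.isAcyclic.subsingleton_path r v).elim ⟨q, hqp⟩ ⟨q', hq'⟩)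
    rw [this]

/-- Recursion along parents, reduced to recursion on the level. It defines depths and rays. -/
theorem exists_rec_parent {α : Type*} {r : V} {par : V → V} {lev : V → ℕ} (h0 : lev r = 0)
    (h : ∀ w, w ≠ r → lev w = lev (par w) + 1) (a : α) (F : V → α → α) :
    ∃ f : V → α, f r = a ∧ ∀ w, w ≠ r → f w = F w (f (par w)) := by
  classical
  let g : ℕ → V → α := fun k => Nat.rec (fun _ => a)
    (fun _ gk w => if w = r then a else F w (gk (par w))) k
  refine ⟨fun v => g (lev v) v, ?_, ?_⟩
  · simp only [h0]; rfl
  · intro w hw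
    simp only [h w hw]
    exact if_neg hw

/-- Parents in a tree with root `r`. -/
theorem exists_parent (hG : G.IsTree) (r : V) :
    ∃ (par : V → V) (lev : V → ℕ), par r = r ∧ lev r = 0 ∧
      (∀ w, w ≠ r → lev w = lev (par w) + 1) ∧
      (∀ u v, G.Adj u v ↔ (u ≠ r ∧ par u = v) ∨ (v ≠ r ∧ par v = u)) ∧
      ∀ v, v ≠ r → par (par v) ≠ v := by
  classical
  choose! f hf hf' using fun v (hv : v ≠ r) => existsUnique_parent hG r hv
  have lev_eq : ∀ w, w ≠ r → G.dist r w = G.dist r (if w = r then r else f w) + 1 := by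
    intro w hw
    rw [if_neg hw]
    exact (hf w hw).2
  have ne_of : ∀ u v, G.dist r u = G.dist r v + 1 → u ≠ r := by
    rintro u v h rfl
    simp at h
  refine ⟨fun v => if v = r then r else f v, fun v => G.dist r v, by simp, by simp, lev_eq, ?_, ?_⟩
  · intro u v
    constructor
    · intro h
      rcases hG.dist_eq_dist_add_one_of_adj r h with h1 | h1
      · left
        have hu := ne_of u v h1
        exact ⟨hu, by simp only [if_neg hu]; exact (hf' u hu v ⟨h.symm, h1⟩).symm⟩
      · right
        have hu := ne_of v u h1
        exact ⟨hu, by simp only [if_neg hu]; exact (hf' v hu u ⟨h, h1⟩).symm⟩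
    · rintro (⟨h, rfl⟩ | ⟨h, rfl⟩)
      · simp only [if_neg h]; exact (hf u h).1.symm
      · simp only [if_neg h]; exact (hf v h).1
  · intro v hv h
    simp only at h
    have h1 := lev_eq v hv
    by_cases h2 : (if v = r then r else f v) = r
    · rw [if_pos h2] at h; exact hv h.symm
    · have h3 := lev_eq _ h2
      rw [h] at h3
      omega

end Rooted
end StoryDrawing

namespace StoryDrawing

/-! ### Execution of loop-free programs -/

namespace Program

/-- The final memory of a loop-free program. -/
def exec : Program → Memory → Memory
  | skip, m => m
  | assign x e, m => m.setVar x (e.eval m)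
  | store a i e, m => m.setArr a (i.eval m) (e.eval m)
  | seq p q, m => q.exec (p.exec m)
  | ite e p q, m => if e.eval m = 0 then q.exec m else p.exec m
  | loop _ _, m => m

/-- The program is loop-free on its way from `m` and all values fit into words. -/
def Ok (B : ℕ) : Program → Memory → Prop
  | skip, _ => True
  | assign _ e, m => e.Fits B m
  | store _ i e, m => i.Fits B m ∧ e.Fits B m
  | seq p q, m => p.Ok B m ∧ q.Ok B (p.exec m)
  | ite e p q, m => e.Fits B m ∧ if e.eval m = 0 then q.Ok B m else p.Ok B m
  | loop _ _, _ => False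

/-- An upper bound for the number of steps of a loop-free program. -/
def cost : Program → ℕ
  | skip => 1
  | assign _ e => e.steps + 1
  | store _ i e => i.steps + e.steps + 1
  | seq p q => p.cost + q.cost
  | ite e p q => e.steps + 1 + (p.cost + q.cost)
  | loop _ _ => 0

/-- Since `cost` counts both branches of a conditional, the time bound depends on the program text
alone. -/
theorem run_exec {B : ℕ} (p : Program) (m : Memory) (h : p.Ok B m) :
    ∃ t ≤ p.cost, Run B p m (p.exec m) t := by
  induction p generalizing m with
  | skip => exact ⟨1, le_rfl, Run.skip m⟩
  | assign x e => exact ⟨_, le_rfl, Run.assign m x e h⟩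
  | store a i e => exact ⟨_, le_rfl, Run.store m a i e h.1 h.2⟩
  | seq p q ihp ihq =>
    obtain ⟨t, ht, hr⟩ := ihp m h.1
    obtain ⟨t', ht', hr'⟩ := ihq _ h.2
    exact ⟨t + t', Nat.add_le_add ht ht', Run.seq _ _ _ _ _ _ _ hr hr'⟩
  | ite e p q ihp ihq =>
    obtain ⟨h1, h2⟩ := h
    by_cases he : e.eval m = 0
    · rw [if_pos he] at h2
      obtain ⟨t, ht, hr⟩ := ihq m h2
      refine ⟨e.steps + 1 + t, by simp only [cost]; omega, ?_⟩
      simp only [exec, if_pos he]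
      exact Run.ite_false _ _ _ _ _ _ h1 he hr
    · rw [if_neg he] at h2
      obtain ⟨t, ht, hr⟩ := ihp m h2
      refine ⟨e.steps + 1 + t, by simp only [cost]; omega, ?_⟩
      simp only [exec, if_neg he]
      exact Run.ite_true _ _ _ _ _ _ h1 he hr
  | loop e p => exact h.elim

end Program

/-! ### Composition rules for runs with time bounds -/

/-- Some run of `p` from `m` takes at most `T` steps and ends in a memory with property `Q`. -/
def Reaches (B : ℕ) (p : Program) (m : Memory) (T : ℕ) (Q : Memory → Prop) : Prop :=
  ∃ m' t, Run B p m m' t ∧ t ≤ T ∧ Q m'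

theorem Reaches.of_exec {B : ℕ} {p : Program} {m : Memory} {Q : Memory → Prop} (h : p.Ok B m)
    (hQ : Q (p.exec m)) : Reaches B p m p.cost Q := by
  obtain ⟨t, ht, hr⟩ := p.run_exec m h
  exact ⟨_, t, hr, ht, hQ⟩

theorem Reaches.seq {B : ℕ} {p q : Program} {m : Memory} {T T' : ℕ} {Q R : Memory → Prop}
    (h : Reaches B p m T Q) (h' : ∀ m', Q m' → Reaches B q m' T' R) :
    Reaches B (.seq p q) m (T + T') R := by
  obtain ⟨m', t, hr, ht, hQ⟩ := h
  obtain ⟨m'', t', hr', ht', hR⟩ := h' m' hQ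
  exact ⟨m'', t + t', Run.seq _ _ _ _ _ _ _ hr hr', Nat.add_le_add ht ht', hR⟩

theorem Reaches.loop_true {B : ℕ} {e : Expr} {p : Program} {m : Memory} {T T' : ℕ}
    {Q R : Memory → Prop} (hf : e.Fits B m) (he : e.eval m ≠ 0)
    (h : Reaches B p m T Q) (h' : ∀ m', Q m' → Reaches B (.loop e p) m' T' R) :
    Reaches B (.loop e p) m (e.steps + 1 + T + T') R := by
  obtain ⟨m', t, hr, ht, hQ⟩ := h
  obtain ⟨m'', t', hr', ht', hR⟩ := h' m' hQ
  exact ⟨m'', _, Run.loop_true _ _ _ _ _ _ _ hf he hr hr', by omega, hR⟩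

theorem Reaches.loop_false {B : ℕ} {e : Expr} {p : Program} {m : Memory} {R : Memory → Prop}
    (hf : e.Fits B m) (he : e.eval m = 0) (hR : R m) :
    Reaches B (.loop e p) m (e.steps + 1) R :=
  ⟨m, _, Run.loop_false _ _ _ hf he, le_rfl, hR⟩

theorem Reaches.mono {B : ℕ} {p : Program} {m : Memory} {T T' : ℕ} {Q Q' : Memory → Prop}
    (h : Reaches B p m T Q) (hT : T ≤ T') (hQ : ∀ m', Q m' → Q' m') : Reaches B p m T' Q' := by
  obtain ⟨m', t, hr, ht, hm⟩ := h
  exact ⟨m', t, hr, ht.trans hT, hQ _ hm⟩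

/-! ### Lists in arrays -/

/-- The linked list `l` starts at the cell `h`; all its cells are among `1, …, K`. -/
def Chain {n : ℕ} (nxt tgt : ℕ → ℕ) (K : ℕ) : ℕ → List (Fin n) → Prop
  | h, [] => h = 0
  | h, w :: l => h ≠ 0 ∧ h ≤ K ∧ tgt h = w ∧ Chain nxt tgt K (nxt h) l

theorem Chain.congr {n : ℕ} {nxt tgt nxt' tgt' : ℕ → ℕ} {K K' : ℕ} (hK : K ≤ K')
    (h1 : ∀ i, i ≤ K → nxt' i = nxt i) (h2 : ∀ i, i ≤ K → tgt' i = tgt i) {h : ℕ}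
    {l : List (Fin n)} (hc : Chain nxt tgt K h l) : Chain nxt' tgt' K' h l := by
  induction l generalizing h with
  | nil => exact hc
  | cons w l ih =>
    obtain ⟨h3, h4, h5, h6⟩ := hc
    exact ⟨h3, h4.trans hK, by rw [h2 h h4, h5], by rw [h1 h h4]; exact ih h6⟩

/-- The array `a` holds the stack `l`, with its top at the highest index. -/
def IsStack {n : ℕ} (a : ℕ → ℕ) : List (Fin n) → Prop
  | [] => True
  | w :: l => a l.length = w ∧ IsStack a l

theorem IsStack.update {n : ℕ} {a : ℕ → ℕ} {l : List (Fin n)} (h : IsStack a l) {i x : ℕ}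
    (hi : l.length ≤ i) : IsStack (Function.update a i x) l := by
  induction l with
  | nil => trivial
  | cons w l ih =>
    simp only [List.length_cons] at hi
    exact ⟨by rw [Function.update_of_ne (by omega)]; exact h.1, ih h.2 (by omega)⟩

/-- The array `a` holds the queue `l` from the index `i` on. -/
def IsQueue {n : ℕ} (a : ℕ → ℕ) : ℕ → List (Fin n) → Prop
  | _, [] => True
  | i, w :: l => a i = w ∧ IsQueue a (i + 1) l

theorem IsQueue.append {n : ℕ} {a : ℕ → ℕ} {l : List (Fin n)} {i : ℕ} (h : IsQueue a i l)
    (w : Fin n) : IsQueue (Function.update a (i + l.length) w) i (l ++ [w]) := by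
  induction l generalizing i with
  | nil => simp [IsQueue]
  | cons x l ih =>
    refine ⟨?_, ?_⟩
    · rw [Function.update_of_ne (by simp)]; exact h.1
    · have := ih h.2
      simpa [Nat.add_comm, Nat.add_left_comm, Nat.add_assoc] using this

/-! ### The program -/

/-- The bucket of the vertex given by `e`. -/
def bucketExpr (e : Expr) : Expr := .bin .div (.bin .sub (.read 0 e) (.lit 1)) (.var 1)

/-- Prepend the edge with the index in the variable `2` to both adjacency lists. -/
def buildBody : Program :=
  .seq (.store 7 (.bin .add (.bin .mul (.lit 2) (.var 2)) (.lit 1)) (.read 2 (.var 2))) <|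
  .seq (.store 6 (.bin .add (.bin .mul (.lit 2) (.var 2)) (.lit 1)) (.read 5 (.read 1 (.var 2)))) <|
  .seq (.store 5 (.read 1 (.var 2)) (.bin .add (.bin .mul (.lit 2) (.var 2)) (.lit 1))) <|
  .seq (.store 7 (.bin .add (.bin .mul (.lit 2) (.var 2)) (.lit 2)) (.read 1 (.var 2))) <|
  .seq (.store 6 (.bin .add (.bin .mul (.lit 2) (.var 2)) (.lit 2)) (.read 5 (.read 2 (.var 2)))) <|
  .seq (.store 5 (.read 2 (.var 2)) (.bin .add (.bin .mul (.lit 2) (.var 2)) (.lit 2))) <|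
  .assign 2 (.bin .add (.var 2) (.lit 1))

def buildCond : Expr := .bin .lt (.bin .add (.var 2) (.lit 1)) (.var 0)

/-- Put the neighbour `w` (variable `8`) of `v` (variable `6`) on the stack or into the queue,
unless it is the parent of `v`. -/
def kidsBody : Program :=
  .seq (.assign 8 (.read 7 (.var 7))) <|
  .seq (.assign 7 (.read 6 (.var 7))) <|
  .ite (.bin .eq (.var 8) (.read 8 (.var 6))) .skip <|
  .seq (.store 8 (.var 8) (.var 6)) <|
  .seq (.assign 9 (.bin .add (.read 10 (.var 6)) (.bin .add
    (.bin .sub (bucketExpr (.var 8)) (bucketExpr (.var 6)))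
    (.bin .sub (bucketExpr (.var 6)) (bucketExpr (.var 8)))))) <|
  .seq (.store 10 (.var 8) (.bin .sub (.var 9) (.bin .mul (.bin .div (.var 9) (.lit 4)) (.lit 4)))) <|
  .ite (.bin .eq (bucketExpr (.var 8)) (bucketExpr (.var 6)))
    (.seq (.store 9 (.var 8) (.bin .add (.read 9 (.var 6)) (.lit 1))) <|
     .seq (.store 12 (.var 3) (.var 8)) (.assign 3 (.bin .add (.var 3) (.lit 1))))
    (.seq (.store 9 (.var 8) (.lit 0)) <|
     .seq (.store 13 (.var 5) (.var 8)) (.assign 5 (.bin .add (.var 5) (.lit 1))))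

/-- Take the next vertex from the stack or from the queue. -/
def popBody : Program :=
  .ite (.bin .lt (.lit 0) (.var 3))
    (.seq (.assign 3 (.bin .sub (.var 3) (.lit 1))) (.assign 6 (.read 12 (.var 3))))
    (.seq (.assign 6 (.read 13 (.var 4))) (.assign 4 (.bin .add (.var 4) (.lit 1))))

/-- Place the vertex in the variable `6`. -/
def placeBody : Program :=
  .seq (.assign 10 (bucketExpr (.var 6))) <|
  .seq (.assign 11 (.read 11 (.var 10))) <|
  .seq (.store 11 (.var 10) (.bin .add (.var 11) (.lit 1))) <|
  .seq (.assign 12 (.read 9 (.var 6))) <|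
  .seq (.assign 13 (.bin .add (.bin .mul (.lit 2) (.var 1))
    (.bin .mul (.lit 2) (.bin .sub (.var 11) (.var 12))))) <|
  .seq (.assign 9 (.bin .mul (.lit 4) (.var 1))) <|
  .seq (.assign 7 (.read 5 (.var 6))) <|
  .ite (.bin .eq (.read 10 (.var 6)) (.lit 0))
    (.seq (.store 3 (.var 6) (.bin .add (.var 9) (.var 13)))
      (.store 4 (.var 6) (.bin .add (.var 9) (.var 12)))) <|
  .ite (.bin .eq (.read 10 (.var 6)) (.lit 1))
    (.seq (.store 3 (.var 6) (.bin .sub (.var 9) (.var 12)))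
      (.store 4 (.var 6) (.bin .add (.var 9) (.var 13)))) <|
  .ite (.bin .eq (.read 10 (.var 6)) (.lit 2))
    (.seq (.store 3 (.var 6) (.bin .sub (.var 9) (.var 13)))
      (.store 4 (.var 6) (.bin .sub (.var 9) (.var 12)))) <|
  .seq (.store 3 (.var 6) (.bin .add (.var 9) (.var 12)))
      (.store 4 (.var 6) (.bin .sub (.var 9) (.var 13)))

def visitBody : Program := .seq (.seq popBody placeBody) (.loop (.var 7) kidsBody)

def visitCond : Expr := .bin .lt (.lit 0) (.bin .add (.var 3) (.bin .sub (.var 5) (.var 4)))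

/-- Build the adjacency lists, then place the vertices in the order of the traversal. -/
def drawProgram : Program :=
  .seq (.loop buildCond buildBody) <| .seq (.assign 5 (.lit 1)) (.loop visitCond visitBody)

end StoryDrawing

namespace StoryDrawing

/-! ### The adjacency lists -/

/-- The adjacency list of `v`, the edges being listed from the last one to the first one. -/
def adjOf {V : Type*} [DecidableEq V] : List (V × V) → V → List V
  | [], _ => []
  | e :: E, v => (if v = e.2 then [e.1] else []) ++ ((if v = e.1 then [e.2] else []) ++ adjOf E v)

theorem mem_adjOf {V : Type*} [DecidableEq V] (E : List (V × V)) (u v : V) :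
    u ∈ adjOf E v ↔ s(v, u) ∈ E.map fun e => s(e.1, e.2) := by
  induction E with
  | nil => simp [adjOf]
  | cons e E ih =>
    simp only [adjOf, List.mem_append, List.map_cons, List.mem_cons, ih, Sym2.eq_iff]
    split_ifs <;> simp only [List.mem_singleton, List.not_mem_nil] <;> grind

theorem nodup_adjOf {V : Type*} [DecidableEq V] (E : List (V × V))
    (h : (E.map fun e => s(e.1, e.2)).Nodup) (hl : ∀ e ∈ E, e.1 ≠ e.2) (v : V) :
    (adjOf E v).Nodup := by
  induction E with
  | nil => simp [adjOf]
  | cons e E ih =>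
    rw [List.map_cons, List.nodup_cons] at h
    have ih' := ih h.2 fun e he => hl e (List.mem_cons_of_mem _ he)
    have hne := hl e List.mem_cons_self
    simp only [adjOf]
    by_cases h1 : v = e.2
    · have h2 : v ≠ e.1 := by rw [h1]; exact hne.symm
      rw [if_pos h1, if_neg h2, List.nil_append, List.singleton_append, List.nodup_cons, mem_adjOf]
      exact ⟨by rw [h1, Sym2.eq_swap]; exact h.1, ih'⟩
    · by_cases h2 : v = e.1
      · rw [if_neg h1, if_pos h2, List.nil_append, List.singleton_append, List.nodup_cons,
          mem_adjOf]
        exact ⟨by rw [h2]; exact h.1, ih'⟩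
      · rw [if_neg h1, if_neg h2]; exact ih'

/-- The memory after the insertion of the first `k` edges. -/
structure BuildRep {n : ℕ} (m₀ : Memory) (E : List (Fin n × Fin n)) (k : ℕ) (m : Memory) :
    Prop where
  var_eq : ∀ x, x ≠ 2 → m.var x = m₀.var x
  counter : m.var 2 = k
  arr_eq : ∀ a, a ≠ 5 → a ≠ 6 → a ≠ 7 → m.arr a = m₀.arr a
  chain : ∀ v : Fin n, Chain (m.arr 6) (m.arr 7) (2 * k) (m.arr 5 v) (adjOf (E.take k).reverse v)

theorem Chain.head_le {n : ℕ} {nxt tgt : ℕ → ℕ} {K h : ℕ} {l : List (Fin n)}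
    (hc : Chain nxt tgt K h l) : h ≤ K := by
  cases l with
  | nil => rw [show h = 0 from hc]; exact Nat.zero_le _
  | cons w l => exact hc.2.1

/-- Edge `k` uses the two fresh cells `2k + 1` and `2k + 2`; index `0` stays free to mark the end of
a list. -/
theorem buildBody_spec {n B k : ℕ} {m₀ m : Memory} {E : List (Fin n × Fin n)}
    (hB : 20 * n ≤ B) (hk : k < E.length) (hkn : k + 1 < n)
    (h1 : ∀ i (h : i < E.length), m₀.arr 1 i = (E[i].1 : ℕ))
    (h2 : ∀ i (h : i < E.length), m₀.arr 2 i = (E[i].2 : ℕ))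
    (hne : ∀ e ∈ E, e.1 ≠ e.2)
    (h : BuildRep m₀ E k m) :
    Reaches B buildBody m buildBody.cost (BuildRep m₀ E (k + 1)) := by
  obtain ⟨hv, hc, ha, hch⟩ := h
  have a1 : m.arr 1 k = (E[k].1 : ℕ) := by rw [ha 1 (by simp) (by simp) (by simp), h1 k hk]
  have a2 : m.arr 2 k = (E[k].2 : ℕ) := by rw [ha 2 (by simp) (by simp) (by simp), h2 k hk]
  obtain ⟨u, hu⟩ : ∃ u, u = E[k].1 := ⟨_, rfl⟩
  obtain ⟨w, hw⟩ : ∃ w, w = E[k].2 := ⟨_, rfl⟩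
  have huw : u ≠ w := by rw [hu, hw]; exact hne _ (List.getElem_mem hk)
  have huw' : (w : ℕ) ≠ (u : ℕ) := fun h => huw (Fin.ext h.symm)
  rw [← hu] at a1
  rw [← hw] at a2
  have hul := u.isLt
  have hwl := w.isLt
  have bu := (hch u).head_le
  have bw := (hch w).head_le
  apply Reaches.of_exec
  · simp [buildBody, Program.Ok, Program.exec, Expr.Fits, Expr.eval, BinOp.apply, Memory.setArr,
      hc, a1, a2, Function.update_of_ne huw']
    omega
  · have htake : (E.take (k + 1)).reverse = E[k] :: (E.take k).reverse := by
      rw [List.take_succ_eq_append_getElem hk]; simp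
    constructor
    · intro x hx
      simp [buildBody, Program.exec, Memory.setArr, Memory.setVar, hx, hv]
    · simp [buildBody, Program.exec, Memory.setArr, Memory.setVar, hc, Expr.eval, BinOp.apply]
    · intro a h5 h6 h7
      simp [buildBody, Program.exec, Memory.setArr, Memory.setVar, h5, h6, h7, ha]
    · intro v
      rw [htake]
      simp only [buildBody, Program.exec, Memory.setArr, Memory.setVar, Expr.eval, BinOp.apply]
      simp [hc, a1, a2, Function.update_of_ne huw', adjOf, ← hu, ← hw]
      -- The existing chains use only cells up to `2k`, which the new writes do not touch.
      have old : Chain (Function.update (Function.update (m.arr 6) (2 * k + 1) (m.arr 5 u))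
          (2 * k + 2) (m.arr 5 w))
          (Function.update (Function.update (m.arr 7) (2 * k + 1) w) (2 * k + 2) u) (2 * (k + 1))
          (m.arr 5 v) (adjOf (E.take k).reverse v) := by
        refine (hch v).congr (by omega) ?_ ?_ <;> intro i hi <;>
          rw [Function.update_of_ne (by omega), Function.update_of_ne (by omega)]
      by_cases hvw : v = w
      · subst hvw
        rw [if_pos rfl, if_neg huw.symm, Function.update_self]
        exact ⟨by omega, by omega, by simp, by simpa using old⟩
      · have hvw' : (v : ℕ) ≠ w := fun h => hvw (Fin.ext h)
        rw [if_neg hvw, Function.update_of_ne hvw']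
        by_cases hvu : v = u
        · subst hvu
          rw [if_pos rfl, Function.update_self]
          exact ⟨by omega, by omega, by simp, by simpa using old⟩
        · have hvu' : (v : ℕ) ≠ u := fun h => hvu (Fin.ext h)
          rw [if_neg hvu, Function.update_of_ne hvu']
          exact old

theorem build_spec {n B : ℕ} {m₀ : Memory} {E : List (Fin n × Fin n)}
    (hB : 20 * n ≤ B) (hE : E.length + 1 = n) (hn : m₀.var 0 = n)
    (h1 : ∀ i (h : i < E.length), m₀.arr 1 i = (E[i].1 : ℕ))
    (h2 : ∀ i (h : i < E.length), m₀.arr 2 i = (E[i].2 : ℕ))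
    (hne : ∀ e ∈ E, e.1 ≠ e.2) (j k : ℕ) (hjk : k + j = E.length) (m : Memory)
    (h : BuildRep m₀ E k m) :
    Reaches B (.loop buildCond buildBody) m
      ((buildCond.steps + 1 + buildBody.cost) * j + (buildCond.steps + 1))
      (BuildRep m₀ E E.length) := by
  have h0 : m.var 0 = n := by rw [h.var_eq 0 (by simp), hn]
  have hk := h.counter
  have hfit : buildCond.Fits B m := by
    simp only [buildCond, Expr.Fits, Expr.eval, BinOp.apply, h0, hk]
    split_ifs <;> omega
  induction j generalizing k m with
  | zero =>
    obtain rfl : k = E.length := by omega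
    refine (Reaches.loop_false hfit ?_ h).mono (by omega) fun _ h => h
    simp only [buildCond, Expr.eval, BinOp.apply, h0, hk]
    rw [if_neg (by omega)]
  | succ j ih =>
    have hc : buildCond.eval m ≠ 0 := by
      simp only [buildCond, Expr.eval, BinOp.apply, h0, hk]
      rw [if_pos (by omega)]
      simp
    refine (Reaches.loop_true
      (T' := (buildCond.steps + 1 + buildBody.cost) * j + (buildCond.steps + 1)) hfit hc
      (buildBody_spec hB (by omega) (by omega) h1 h2 hne h) fun m' h' => ?_).mono ?_ fun _ h => h
    · have h0' : m'.var 0 = n := by rw [h'.var_eq 0 (by simp), hn]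
      have hk' := h'.counter
      refine ih (k + 1) (by omega) m' h' h0' hk' ?_
      simp only [buildCond, Expr.Fits, Expr.eval, BinOp.apply, h0', hk']
      split_ifs <;> omega
    · rw [Nat.mul_succ]; omega

end StoryDrawing

namespace StoryDrawing

open Traversal

/-! ### The program performs the traversal -/

/-- The data of the traversal of a tree story with vertices `0, …, n - 1`. -/
structure IsSetting {n : ℕ} (W : ℕ) (time : Fin n → ℕ) (root : Fin n) (par : Fin n → Fin n)
    (bucket dep ray : Fin n → ℕ) (adj : Fin n → List (Fin n)) : Prop where
  root_val : (root : ℕ) = 0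
  window_pos : 0 < W
  par_root : par root = root
  tree : IsBucketTree root par bucket dep fun v => (adj v).filter fun w => w ≠ par v
  adj_nodup : ∀ v, (adj v).Nodup
  dep_root : dep root = 0
  ray_root : ray root = 0
  ray_eq : ∀ w, w ≠ root →
    ray w = (ray (par w) + ((bucket w - bucket (par w)) + (bucket (par w) - bucket w))) % 4
  time_le : ∀ v, time v ≤ n
  bucket_eq : ∀ v, (time v - 1) / W = bucket v

/-- The memory `m` holds the input, the adjacency lists, the stack and the queue of the state `st`,
and the data of the discovered vertices. -/
structure RepCore {n : ℕ} (W : ℕ) (time : Fin n → ℕ) (root : Fin n) (par : Fin n → Fin n)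
    (dep ray : Fin n → ℕ) (adj : Fin n → List (Fin n)) (m : Memory)
    (st : Traversal (Fin n)) : Prop where
  window : m.var 1 = W
  times : ∀ v : Fin n, m.arr 0 v = time v
  chain : ∀ v : Fin n, Chain (m.arr 6) (m.arr 7) (2 * n) (m.arr 5 v) (adj v)
  sp : m.var 3 = st.stk.length
  stack : IsStack (m.arr 12) st.stk
  qt : m.var 5 = m.var 4 + st.que.length
  queue : IsQueue (m.arr 13) (m.var 4) st.que
  qh : m.var 4 ≤ st.vis.length
  disc : ∀ v, v = root ∨ v ∈ st.vis ∨ v ∈ st.stk ∨ v ∈ st.que →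
    m.arr 8 v = par v ∧ m.arr 9 v = dep v ∧ m.arr 10 v = ray v

/-- The memory `m` holds the numbers of visited vertices of the buckets and the coordinates of the
visited vertices. -/
structure RepOut {n : ℕ} (W : ℕ) (bucket dep ray : Fin n → ℕ) (m : Memory)
    (st : Traversal (Fin n)) : Prop where
  count : ∀ k, m.arr 11 k = st.count bucket k
  out : ∀ v ∈ st.vis, (m.arr 3 v, m.arr 4 v) = gridPoint W (st.idx v) (dep v) (ray v)

/-- The memory `m` represents the state `st` of the traversal. -/
structure Rep {n : ℕ} (W : ℕ) (time : Fin n → ℕ) (root : Fin n) (par : Fin n → Fin n)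
    (bucket dep ray : Fin n → ℕ) (adj : Fin n → List (Fin n)) (m : Memory)
    (st : Traversal (Fin n)) : Prop
    extends RepCore W time root par dep ray adj m st, RepOut W bucket dep ray m st

variable {n W : ℕ} {time : Fin n → ℕ} {root : Fin n} {par : Fin n → Fin n}
  {bucket dep ray : Fin n → ℕ} {adj : Fin n → List (Fin n)}

theorem IsSetting.bucket_le (D : IsSetting W time root par bucket dep ray adj) (v : Fin n) :
    bucket v ≤ n := by
  rw [← D.bucket_eq]
  exact (Nat.div_le_self _ _).trans ((Nat.sub_le _ _).trans (D.time_le v))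

theorem IsSetting.ray_lt (D : IsSetting W time root par bucket dep ray adj) (v : Fin n) :
    ray v < 4 := by
  by_cases h : v = root
  · rw [h, D.ray_root]; simp
  · rw [D.ray_eq v h]; omega

/-- The state after the neighbour `w` of `v` has been handled. -/
def push (par : Fin n → Fin n) (bucket : Fin n → ℕ) (v w : Fin n) (st : Traversal (Fin n)) :
    Traversal (Fin n) :=
  if w = par v then st
  else if bucket w = bucket v then { st with stk := w :: st.stk }
  else { st with que := st.que ++ [w] }

theorem push_vis (par : Fin n → Fin n) (bucket : Fin n → ℕ) (v w : Fin n)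
    (st : Traversal (Fin n)) : (push par bucket v w st).vis = st.vis := by
  unfold push; split_ifs <;> rfl

theorem push_stk_length (par : Fin n → Fin n) (bucket : Fin n → ℕ) (v w : Fin n)
    (st : Traversal (Fin n)) :
    (push par bucket v w st).stk.length ≤ st.stk.length + 1 := by
  unfold push; split_ifs <;> simp

/-- Only the record of the newly discovered `w` changes, and it is computed from the record of `v`,
which was discovered earlier. -/
theorem kidsBody_spec (D : IsSetting W time root par bucket dep ray adj) {B : ℕ}
    (hB : 20 * n + 20 * W ≤ B) {m : Memory} {st : Traversal (Fin n)}
    (R : Rep W time root par bucket dep ray adj m st) {v w : Fin n} {l : List (Fin n)}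
    (hv : v ∈ st.vis) (h6 : m.var 6 = v) (hd : dep v ≤ n)
    (h7 : Chain (m.arr 6) (m.arr 7) (2 * n) (m.var 7) (w :: l))
    (hw : w = par v ∨ w ≠ root ∧ par w = v)
    (hsp : st.stk.length ≤ 2 * n) (hqt : m.var 5 ≤ 3 * n) :
    Reaches B kidsBody m kidsBody.cost fun m' =>
      Rep W time root par bucket dep ray adj m' (push par bucket v w st) ∧ m'.var 6 = v ∧
        Chain (m'.arr 6) (m'.arr 7) (2 * n) (m'.var 7) l ∧ m'.var 5 ≤ m.var 5 + 1 := by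
  obtain ⟨c1, c2, c3, c4⟩ := h7
  have c5 : m.arr 6 (m.var 7) ≤ 2 * n := c4.head_le
  obtain ⟨p1, p2, p3⟩ := R.disc v (Or.inr (Or.inl hv))
  have hvl := v.isLt
  have hwl := w.isLt
  have hpl := (par v).isLt
  have hr := D.ray_lt v
  have hbv := D.bucket_le v
  have hbw := D.bucket_le w
  have hn := D.window_pos
  have Rw := R.window
  have tv := D.time_le v
  have tw := D.time_le w
  have Rsp := R.sp
  have wv : (w : ℕ) = par v ↔ w = par v := by rw [Fin.ext_iff]
  by_cases hwp : w = par v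
  · apply Reaches.of_exec
    · simp [kidsBody, Program.Ok, Program.exec, Expr.Fits, Expr.eval, BinOp.apply,
        Memory.setVar, c3, h6, p1, hwp]
      omega
    · simp [kidsBody, Program.exec, Expr.eval, BinOp.apply,
        Memory.setVar, c3, h6, p1, hwp, push]
      refine ⟨?_, c4⟩
      obtain ⟨⟨r1, r2, r3, r4, r5, r6, r7, r8, r9⟩, ⟨r10, r11⟩⟩ := R
      refine ⟨⟨?_, ?_, ?_, ?_, ?_, ?_, ?_, ?_, ?_⟩, ⟨?_, ?_⟩⟩ <;> first | exact r9 | simpa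
  · obtain ⟨hwr, hpw⟩ := hw.resolve_left hwp
    have hray := D.ray_eq w hwr
    rw [hpw] at hray
    have hupd : ∀ u : Fin n, u ≠ w → ∀ (a : ℕ → ℕ) (x : ℕ), Function.update a w x u = a u :=
      fun u hu a x => Function.update_of_ne (fun h => hu (Fin.ext h)) _ _
    apply Reaches.of_exec
    · simp [kidsBody, Program.Ok, Program.exec, Expr.Fits, Expr.eval, BinOp.apply, bucketExpr,
        Memory.setVar, Memory.setArr, c3, h6, p1, hwp, wv, p2, p3, R.times, Rw, D.bucket_eq, Rsp]
      split_ifs <;> and_intros <;> omega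
    · by_cases hb : bucket w = bucket v
      · have hdep := D.tree.in_dep hwr (by rw [hpw, hb])
        rw [hpw] at hdep
        rw [hb] at hray
        simp [kidsBody, Program.exec, Expr.eval, BinOp.apply, bucketExpr,
          Memory.setVar, Memory.setArr, c3, h6, p1, hwp, wv, p2, p3, R.times, Rw, D.bucket_eq, Rsp,
          push, hb]
        refine ⟨?_, c4⟩
        obtain ⟨⟨r1, r2, r3, r4, r5, r6, r7, r8, r9⟩, ⟨r10, r11⟩⟩ := R
        refine ⟨⟨?_, ?_, ?_, ?_, ?_, ?_, ?_, ?_, ?_⟩, ⟨?_, ?_⟩⟩ <;> try first | (simp; done) | simpa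
        · exact ⟨Function.update_self _ _ _, r5.update le_rfl⟩
        · intro u hu
          by_cases huw : u = w
          · subst huw
            simp [hdep, hpw]
            omega
          · simp [hupd u huw]
            apply r9
            simpa [huw] using hu
      · have hdep := D.tree.out_dep hwr (by rw [hpw]; exact fun h => hb h.symm)
        simp [kidsBody, Program.exec, Expr.eval, BinOp.apply, bucketExpr,
          Memory.setVar, Memory.setArr, c3, h6, p1, hwp, wv, p3, R.times, Rw, D.bucket_eq,
          push, hb]
        refine ⟨?_, c4⟩
        obtain ⟨⟨r1, r2, r3, r4, r5, r6, r7, r8, r9⟩, ⟨r10, r11⟩⟩ := R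
        refine ⟨⟨?_, ?_, ?_, ?_, ?_, ?_, ?_, ?_, ?_⟩, ⟨?_, ?_⟩⟩ <;> try first | (simp; done) | simpa
        · simp [r6]; omega
        · have := r7.append w
          simpa [r6] using this
        · intro u hu
          by_cases huw : u = w
          · subst huw
            simp [hdep, hpw]
            omega
          · simp [hupd u huw]
            apply r9
            simpa [huw] using hu

/-- The state after all the neighbours in `l` have been handled. -/
theorem foldl_push (v : Fin n) (l : List (Fin n)) (st : Traversal (Fin n)) :
    l.foldl (fun st w => push par bucket v w st) st =
      { st with
        stk := ((l.filter fun w => w ≠ par v).filter fun w => bucket w = bucket v).reverse ++ st.stk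
        que := st.que ++ (l.filter fun w => w ≠ par v).filter fun w => ¬ bucket w = bucket v } := by
  induction l generalizing st with
  | nil => simp
  | cons w l ih =>
    rw [List.foldl_cons, ih, push]
    by_cases h1 : w = par v
    · simp [h1]
    · by_cases h2 : bucket w = bucket v <;> simp [h1, h2]

theorem kidsLoop_spec (D : IsSetting W time root par bucket dep ray adj) {B : ℕ}
    (hB : 20 * n + 20 * W ≤ B) {v : Fin n} (hd : dep v ≤ n) (l : List (Fin n))
    {m : Memory} {st : Traversal (Fin n)}
    (R : Rep W time root par bucket dep ray adj m st)
    (hv : v ∈ st.vis) (h6 : m.var 6 = v)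
    (h7 : Chain (m.arr 6) (m.arr 7) (2 * n) (m.var 7) l)
    (hw : ∀ w ∈ l, w = par v ∨ w ≠ root ∧ par w = v)
    (hsp : st.stk.length + l.length ≤ 2 * n) (hqt : m.var 5 + l.length ≤ 3 * n) :
    Reaches B (.loop (.var 7) kidsBody) m ((2 + kidsBody.cost) * l.length + 2) fun m' =>
      Rep W time root par bucket dep ray adj m'
        (l.foldl (fun st w => push par bucket v w st) st) := by
  induction l generalizing m st with
  | nil =>
    have h : m.var 7 = 0 := h7
    exact (Reaches.loop_false (e := .var 7) (by simp [Expr.Fits, h]) (by simpa [Expr.eval]) R).mono (by simp [Expr.steps])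
      fun _ h => h
  | cons w l ih =>
    have h7' := h7
    obtain ⟨c1, c2, -⟩ := h7'
    rw [List.length_cons] at hsp hqt
    refine (Reaches.loop_true (T' := (2 + kidsBody.cost) * l.length + 2)
      (e := .var 7) (by simp only [Expr.Fits]; omega) (by simpa [Expr.eval])
      (kidsBody_spec D hB R hv h6 hd h7 (hw w List.mem_cons_self) (by omega) (by omega))
      ?_).mono ?_ fun _ h => h
    · rintro m' ⟨R', h6', h7', h5'⟩
      refine ih R' ?_ h6' h7' (fun w hw' => hw w (List.mem_cons_of_mem _ hw')) ?_ (by omega)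
      · rwa [push_vis]
      · have := push_stk_length par bucket v w st
        simp only
        omega
    · simp only [Expr.steps, List.length_cons, Nat.mul_succ]; omega

/-- Here `v` already counts as visited for the core data, whereas the bucket counts and coordinates
still describe the old state; this is why the representation is split in two. -/
theorem popBody_spec {B : ℕ}
    (hB : 20 * n + 20 * W ≤ B) (hn : 0 < n) {m : Memory} {st : Traversal (Fin n)}
    (R : Rep W time root par bucket dep ray adj m st) (hne : st.stk ≠ [] ∨ st.que ≠ [])
    (hs : st.stk.length ≤ n) (hq : m.var 4 ≤ n) :
    ∃ v S Q, st.Next v S Q ∧ Reaches B popBody m popBody.cost fun m' =>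
      RepCore W time root par dep ray adj m' { st with vis := st.vis ++ [v], stk := S, que := Q } ∧
        RepOut W bucket dep ray m' st ∧ m'.var 6 = v := by
  obtain ⟨⟨r1, r2, r3, r4, r5, r6, r7, r8, r9⟩, ⟨r10, r11⟩⟩ := R
  rcases hS : st.stk with _ | ⟨v, S⟩
  · rcases hQ : st.que with _ | ⟨v, Q⟩
    · simp [hS, hQ] at hne
    · rw [hS] at r4
      rw [hQ] at r7 r6
      refine ⟨v, [], Q, Or.inr ⟨hS, rfl, hQ⟩, Reaches.of_exec ?_ ?_⟩
      · have := v.isLt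
        simp [popBody, Program.Ok, Program.exec, Expr.Fits, Expr.eval, BinOp.apply, r4, r7.1,
          Memory.setVar]
        omega
      · simp [popBody, Program.exec, Expr.eval, BinOp.apply, Memory.setVar, r4, r7.1]
        refine ⟨⟨?_, ?_, ?_, ?_, ?_, ?_, ?_, ?_, ?_⟩, ⟨?_, ?_⟩⟩ <;> try simpa
        · trivial
        · simp at r6 ⊢; omega
        · simpa using r7.2
        · intro u hu
          apply r9
          simp [hS, hQ] at hu ⊢
          tauto
  · rw [hS] at r4 r5
    refine ⟨v, S, st.que, Or.inl ⟨hS, rfl⟩, Reaches.of_exec ?_ ?_⟩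
    · have := v.isLt
      rw [hS] at hs
      simp at hs
      simp [popBody, Program.Ok, Program.exec, Expr.Fits, Expr.eval, BinOp.apply, r4, r5.1,
        Memory.setVar]
      omega
    · simp [popBody, Program.exec, Expr.eval, BinOp.apply, Memory.setVar, r4, r5.1]
      refine ⟨⟨?_, ?_, ?_, ?_, ?_, ?_, ?_, ?_, ?_⟩, ⟨?_, ?_⟩⟩ <;> try first | (simp; done) | simpa
      · simpa using r5.2
      · simp; omega
      · intro u hu
        apply r9
        simp [hS] at hu ⊢
        tauto

theorem placeBody_spec (D : IsSetting W time root par bucket dep ray adj) {B : ℕ}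
    (hB : 20 * n + 20 * W ≤ B) {m : Memory} {st : Traversal (Fin n)} {v : Fin n}
    {S Q : List (Fin n)}
    (R : RepCore W time root par dep ray adj m { st with vis := st.vis ++ [v], stk := S, que := Q })
    (R' : RepOut W bucket dep ray m st) (h6 : m.var 6 = v)
    (hc : st.count bucket (bucket v) ≤ n) (hd : dep v ≤ st.count bucket (bucket v)) :
    Reaches B placeBody m placeBody.cost fun m' =>
      Rep W time root par bucket dep ray adj m' ⟨st.vis ++ [v], S, Q,
          Function.update st.idx v (st.count bucket (bucket v))⟩ ∧
        m'.var 6 = v ∧ Chain (m'.arr 6) (m'.arr 7) (2 * n) (m'.var 7) (adj v) ∧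
          m'.var 5 = m.var 5 := by
  obtain ⟨r1, r2, r3, r4, r5, r6, r7, r8, r9⟩ := R
  obtain ⟨r10, r11⟩ := R'
  obtain ⟨p1, p2, p3⟩ := r9 v (by simp)
  have hvl := v.isLt
  have hr := D.ray_lt v
  have hb := D.bucket_le v
  have hW := D.window_pos
  have ht := D.time_le v
  have hch : m.arr 5 v ≤ 2 * n := (r3 v).head_le
  apply Reaches.of_exec
  · simp [placeBody, Program.Ok, Program.exec, Expr.Fits, Expr.eval, BinOp.apply, bucketExpr,
      Memory.setVar, Memory.setArr, h6, r1, r2, p2, p3, r10, D.bucket_eq]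
    split_ifs <;> and_intros <;> omega
  · have hupd : ∀ u : Fin n, u ≠ v → ∀ (a : ℕ → ℕ) (x : ℕ), Function.update a v x u = a u :=
      fun u hu a x => Function.update_of_ne (fun h => hu (Fin.ext h)) _ _
    have hcnt : ∀ k, Function.update (m.arr 11) (bucket v) (count bucket st (bucket v) + 1) k =
        count bucket (⟨st.vis ++ [v], S, Q,
          Function.update st.idx v (st.count bucket (bucket v))⟩ : Traversal (Fin n)) k := by
      intro k
      by_cases hk : k = bucket v
      · subst hk
        simp [count, List.countP_append]
      · rw [Function.update_of_ne hk, r10]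
        simp [count, List.countP_append, Ne.symm hk]
    have hout : ∀ x y : ℕ, (x, y) = gridPoint W (count bucket st (bucket v)) (dep v) (ray v) →
        ∀ u ∈ st.vis ++ [v],
          (Function.update (m.arr 3) v x u, Function.update (m.arr 4) v y u) =
            gridPoint W (Function.update st.idx v (st.count bucket (bucket v)) u) (dep u)
              (ray u) := by
      intro x y hxy u hu
      by_cases huv : u = v
      · subst huv
        simpa using hxy
      · rw [hupd u huv, hupd u huv, Function.update_of_ne huv]
        refine r11 u ?_
        simpa [huv] using hu
    -- The four ray branches differ only in the stored coordinates, so everything else is settled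
    -- once.
    have hbase : ∀ m' : Memory, m'.var 1 = m.var 1 → m'.var 3 = m.var 3 → m'.var 4 = m.var 4 →
        m'.var 5 = m.var 5 → m'.var 6 = m.var 6 → m'.var 7 = m.arr 5 v →
        (∀ a, a ≠ 3 → a ≠ 4 → a ≠ 11 → m'.arr a = m.arr a) →
        m'.arr 11 = Function.update (m.arr 11) (bucket v) (count bucket st (bucket v) + 1) →
        m'.arr 3 = Function.update (m.arr 3) v
          (gridPoint W (count bucket st (bucket v)) (dep v) (ray v)).1 →
        m'.arr 4 = Function.update (m.arr 4) v
          (gridPoint W (count bucket st (bucket v)) (dep v) (ray v)).2 →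
        Rep W time root par bucket dep ray adj m' ⟨st.vis ++ [v], S, Q,
          Function.update st.idx v (st.count bucket (bucket v))⟩ ∧
        m'.var 6 = v ∧ Chain (m'.arr 6) (m'.arr 7) (2 * n) (m'.var 7) (adj v) ∧
          m'.var 5 = m.var 5 := by
      rintro m' v1 v3 v4 v5 v6 v7 ha a11 a3 a4
      have a0 := ha 0 (by simp) (by simp) (by simp)
      have a5 := ha 5 (by simp) (by simp) (by simp)
      have a6 := ha 6 (by simp) (by simp) (by simp)
      have a7 := ha 7 (by simp) (by simp) (by simp)
      have a8 := ha 8 (by simp) (by simp) (by simp)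
      have a9 := ha 9 (by simp) (by simp) (by simp)
      have a10 := ha 10 (by simp) (by simp) (by simp)
      have a12 := ha 12 (by simp) (by simp) (by simp)
      have a13 := ha 13 (by simp) (by simp) (by simp)
      refine ⟨⟨⟨?_, ?_, ?_, ?_, ?_, ?_, ?_, ?_, ?_⟩, ⟨?_, ?_⟩⟩, ?_, ?_, v5⟩
      · rw [v1, r1]
      · rw [a0]; exact r2
      · rw [a5, a6, a7]; exact r3
      · rw [v3]; exact r4
      · rw [a12]; exact r5
      · rw [v5, v4]; exact r6
      · rw [a13, v4]; exact r7
      · rw [v4]; exact r8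
      · rw [a8, a9, a10]; exact r9
      · rw [a11]; exact hcnt
      · rw [a3, a4]; exact hout _ _ rfl
      · rw [v6, h6]
      · rw [a6, a7, v7]; exact r3 v
    have hr4 : ray v = 0 ∨ ray v = 1 ∨ ray v = 2 ∨ ray v = 3 := by omega
    rcases hr4 with h | h | h | h <;>
    · obtain ⟨m', hm⟩ : ∃ m', placeBody.exec m = m' := ⟨_, rfl⟩
      rw [hm]
      simp [placeBody, Program.exec, Expr.eval, BinOp.apply, bucketExpr, Memory.setVar,
        Memory.setArr, h6, r1, r2, p2, p3, r10, D.bucket_eq, h] at hm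
      subst hm
      refine hbase _ ?_ ?_ ?_ ?_ ?_ ?_ ?_ ?_ ?_ ?_
      · simp
      · simp
      · simp
      · simp
      · simp
      · simp
      · intro a h3 h4 h11
        simp [h3, h4, h11]
      · simp
      · simp [gridPoint, h]
      · simp [gridPoint, h]

/-- The memory follows an abstract visit: popping and placing, then folding `push` over the
neighbours, yields exactly `Traversal.visit`. -/
theorem visitBody_spec (D : IsSetting W time root par bucket dep ray adj) {B : ℕ}
    (hB : 20 * n + 20 * W ≤ B) {m : Memory} {st : Traversal (Fin n)}
    (R : Rep W time root par bucket dep ray adj m st) (I : Inv root par bucket dep st)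
    (hne : st.stk ≠ [] ∨ st.que ≠ []) :
    ∃ v, v ∉ st.vis ∧ Reaches B visitBody m
      (popBody.cost + placeBody.cost + ((2 + kidsBody.cost) * (adj v).length + 2)) fun m' =>
        ∃ st', st'.vis = st.vis ++ [v] ∧ Inv root par bucket dep st' ∧
          Rep W time root par bucket dep ray adj m' st' := by
  have hlen := I.nodup.length_le_card
  simp only [List.length_append, Fintype.card_fin] at hlen
  have hn : 0 < n := Fin.pos root
  have hqh := R.qh
  have hqt := R.qt
  obtain ⟨v, S, Q, hnext, hpop⟩ := popBody_spec hB hn R hne (by omega) (by omega)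
  have hmem : v ∈ st.stk ++ st.que ∧ S.length ≤ st.stk.length ∧ Q.length ≤ st.que.length := by
    rcases hnext with ⟨h1, h2⟩ | ⟨h1, h2, h3⟩
    · simp [h1, h2]
    · simp [h1, h2, h3]
  have hvv : v ∉ st.vis := fun hv => (List.nodup_append.1 I.nodup).2.2 v hv v hmem.1 rfl
  have hcnt : st.count bucket (bucket v) ≤ n := by
    have : st.count bucket (bucket v) ≤ st.vis.length := List.countP_le_length
    omega
  obtain ⟨hdv, -⟩ := next_dep_le D.tree I hnext
  have hadj : (adj v).length ≤ n := by
    simpa using (D.adj_nodup v).length_le_card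
  refine ⟨v, hvv, (Reaches.seq (Reaches.seq hpop (R := fun m' =>
      Rep W time root par bucket dep ray adj m' ⟨st.vis ++ [v], S, Q,
          Function.update st.idx v (st.count bucket (bucket v))⟩ ∧
        m'.var 6 = v ∧ Chain (m'.arr 6) (m'.arr 7) (2 * n) (m'.var 7) (adj v)) ?_) ?_)⟩
  · rintro m' ⟨h1, h2, h3⟩
    exact (placeBody_spec D hB h1 h2 h3 hcnt hdv).mono le_rfl fun m'' h => ⟨h.1, h.2.1, h.2.2.1⟩
  · rintro m' ⟨h1, h2, h3⟩
    refine (kidsLoop_spec D hB (hdv.trans hcnt) (adj v) h1 (by simp) h2 h3 ?_ ?_ ?_).mono le_rfl ?_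
    · intro w hw
      by_cases hwp : w = par v
      · exact Or.inl hwp
      · exact Or.inr (D.tree.mem_kids.1 (by simp [hw, hwp]))
    · simp only; omega
    · have e1 := h1.qt
      have e2 := h1.qh
      simp only [List.length_append, List.length_singleton] at e1 e2
      omega
    · intro m'' h
      rw [foldl_push] at h
      exact ⟨_, rfl, inv_visit D.tree I hnext, h⟩

/-- A bound for the number of steps spent on a vertex with `d` neighbours. -/
def visitCost (d : ℕ) : ℕ :=
  visitCond.steps + 1 + (popBody.cost + placeBody.cost + ((2 + kidsBody.cost) * d + 2))

/-- Each round visits a new vertex `v` at a cost affine in its degree; summing over the unvisited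
vertices makes the cost amortize over the edges. -/
theorem visitLoop_spec (D : IsSetting W time root par bucket dep ray adj) {B : ℕ}
    (hB : 20 * n + 20 * W ≤ B) (k : ℕ) {m : Memory} {st : Traversal (Fin n)}
    (hk : (Finset.univ.filter fun v => v ∉ st.vis).card = k)
    (R : Rep W time root par bucket dep ray adj m st) (I : Inv root par bucket dep st) :
    Reaches B (.loop visitCond visitBody) m
      (∑ v ∈ Finset.univ.filter (fun v => v ∉ st.vis), visitCost (adj v).length +
        (visitCond.steps + 1)) fun m' =>
        ∃ st', Inv root par bucket dep st' ∧ st'.stk = [] ∧ st'.que = [] ∧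
          Rep W time root par bucket dep ray adj m' st' := by
  have hlen := I.nodup.length_le_card
  simp only [List.length_append, Fintype.card_fin] at hlen
  have hn : 0 < n := Fin.pos root
  have hsp := R.sp
  have hqt := R.qt
  have hqh := R.qh
  have heval : visitCond.eval m = if 0 < m.var 3 + (m.var 5 - m.var 4) then 1 else 0 := rfl
  have hfit : visitCond.Fits B m := by
    have hle : visitCond.eval m ≤ B := by rw [heval]; split_ifs <;> omega
    refine ⟨Nat.zero_le _, ⟨?_, ⟨?_, ?_, ?_⟩, ?_⟩, hle⟩ <;>
      simp only [Expr.Fits, Expr.eval, BinOp.apply] <;> omega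
  by_cases hne : st.stk ≠ [] ∨ st.que ≠ []
  · have hc : visitCond.eval m ≠ 0 := by
      rw [heval, if_pos]
      · simp
      · simp only [← List.length_pos_iff] at hne
        omega
    obtain ⟨v, hv, hbody⟩ := visitBody_spec D hB R I hne
    have hset : Finset.univ.filter (fun u => u ∉ st.vis) =
        insert v (Finset.univ.filter fun u => u ∉ st.vis ++ [v]) := by
      ext u
      by_cases huv : u = v
      · simp [huv, hv]
      · simp [huv]
    have hnot : v ∉ Finset.univ.filter fun u => u ∉ st.vis ++ [v] := by simp
    cases k with
    | zero =>
      rw [Finset.card_eq_zero] at hk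
      exact absurd (hk ▸ Finset.mem_filter.2 ⟨Finset.mem_univ v, hv⟩) (Finset.notMem_empty v)
    | succ k =>
      refine (Reaches.loop_true (T' := ∑ u ∈ Finset.univ.filter (fun u => u ∉ st.vis ++ [v]),
        visitCost (adj u).length + (visitCond.steps + 1)) hfit hc hbody ?_).mono ?_ fun _ h => h
      · rintro m' ⟨st', hvis, I', R'⟩
        rw [hset, Finset.card_insert_of_notMem hnot] at hk
        rw [← hvis] at hk ⊢
        exact visitLoop_spec D hB k (by omega) R' I'
      · conv_rhs => rw [hset, Finset.sum_insert hnot]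
        simp only [visitCost]
        omega
  · rw [not_or, not_not, not_not] at hne
    refine (Reaches.loop_false hfit ?_ ⟨st, I, hne.1, hne.2, R⟩).mono (Nat.le_add_left _ _)
      fun _ h => h
    rw [heval, if_neg]
    simp only [hne.1, hne.2, List.length_nil] at hsp hqt
    omega

/-! ### Total cost and correctness of the program -/

theorem sum_length_adjOf {V : Type*} [Fintype V] [DecidableEq V] (E : List (V × V)) :
    ∑ v, (adjOf E v).length = 2 * E.length := by
  induction E with
  | nil => simp [adjOf]
  | cons e E ih =>
    have h : ∀ v, (adjOf (e :: E) v).length =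
        (if v = e.2 then 1 else 0) + ((if v = e.1 then 1 else 0) + (adjOf E v).length) := by
      intro v
      simp only [adjOf, List.length_append]
      split_ifs <;> simp
    simp only [h, Finset.sum_add_distrib, ih, Finset.sum_ite_eq', Finset.mem_univ, if_true,
      List.length_cons]
    omega

theorem IsEdgeList.length_eq {V : Type*} [Fintype V] {G : SimpleGraph V} (hG : G.IsTree)
    {E : List (V × V)} (hE : IsEdgeList G E) : E.length + 1 = Fintype.card V := by
  classical
  rw [← hG.card_edgeFinset, ← List.length_map (as := E) fun e => s(e.1, e.2),
    ← List.toFinset_card_of_nodup hE.1]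
  congr 2
  ext e
  rw [List.mem_toFinset, SimpleGraph.mem_edgeFinset, hE.2 e]

theorem mem_adjOf_reverse {V : Type*} [DecidableEq V] {G : SimpleGraph V} {E : List (V × V)}
    (hE : IsEdgeList G E) (u v : V) : u ∈ adjOf E.reverse v ↔ G.Adj v u := by
  rw [mem_adjOf, List.map_reverse, List.mem_reverse, ← hE.2, SimpleGraph.mem_edgeSet]

theorem IsEdgeList.fst_ne_snd {V : Type*} {G : SimpleGraph V} {E : List (V × V)}
    (hE : IsEdgeList G E) {e : V × V} (he : e ∈ E) : e.1 ≠ e.2 := by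
  have : s(e.1, e.2) ∈ G.edgeSet := (hE.2 _).2 (List.mem_map.2 ⟨e, he, rfl⟩)
  exact (SimpleGraph.mem_edgeSet _).1 this |>.ne

/-- The root is vertex `0` and is its own parent. Thus zero-initialized memory already holds its
parent, depth and ray, and the parent test skips none of its neighbours. -/
theorem exists_setting {S : GraphStory (Fin n)} {E : List (Fin n × Fin n)}
    (hS : S.graph.IsTree) (hE : IsEdgeList S.graph E) (hn : 0 < n) :
    ∃ (par : Fin n → Fin n) (dep ray : Fin n → ℕ),
      IsSetting S.window S.time ⟨0, hn⟩ par S.bucket dep ray (adjOf E.reverse) ∧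
      ∀ u v, S.graph.Adj u v → (v ≠ ⟨0, hn⟩ ∧ par v = u) ∨ (u ≠ ⟨0, hn⟩ ∧ par u = v) := by
  obtain ⟨par, lev, h1, h2, h3, h4, h5⟩ := exists_parent hS ⟨0, hn⟩
  obtain ⟨dep, d1, d2⟩ := exists_rec_parent h2 h3 0
    (fun w d => if S.bucket (par w) = S.bucket w then d + 1 else 0)
  obtain ⟨ray, r1, r2⟩ := exists_rec_parent h2 h3 0
    (fun w r => (r + ((S.bucket w - S.bucket (par w)) + (S.bucket (par w) - S.bucket w))) % 4)
  have hnd : ∀ v, (adjOf E.reverse v).Nodup := by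
    refine nodup_adjOf _ ?_ ?_
    · rw [List.map_reverse, List.nodup_reverse]; exact hE.1
    · intro e he
      exact hE.fst_ne_snd (List.mem_reverse.1 he)
  refine ⟨par, dep, ray, ?_, fun u v h => ((h4 u v).1 h).symm⟩
  refine ⟨rfl, S.window_pos, h1, ?_, hnd, d1, r1, r2, fun v => ?_, fun v => rfl⟩
  · refine ⟨?_, fun p => (hnd p).filter _, ?_, ?_, d1, ?_⟩
    · intro p w
      rw [List.mem_filter, mem_adjOf_reverse hE, h4, decide_eq_true_eq]
      constructor
      · rintro ⟨⟨_, h⟩ | h, hne⟩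
        · exact absurd h.symm hne
        · exact h
      · rintro ⟨hw, rfl⟩
        exact ⟨Or.inr ⟨hw, rfl⟩, (h5 w hw).symm⟩
    · intro w hw hb
      rw [d2 w hw, if_pos hb]
    · intro w hw hb
      rw [d2 w hw, if_neg hb]
    · intro P hroot hstep w
      induction hl : lev w generalizing w with
      | zero =>
        by_cases hw : w = ⟨0, hn⟩
        · rw [hw]; exact hroot
        · have := h3 w hw; omega
      | succ l ih =>
        by_cases hw : w = ⟨0, hn⟩
        · rw [hw]; exact hroot
        · exact hstep w hw (ih _ (by have := h3 w hw; omega))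
  · simpa using S.time_le v

/-- The constant in the bounds for the time and for the values. -/
def drawConst : ℕ :=
  20 + (buildCond.steps + 1 + buildBody.cost) + (buildCond.steps + 1) + 2 + visitCost 0 +
    2 * (2 + kidsBody.cost) + (visitCond.steps + 1)

theorem visitCost_eq (d : ℕ) : visitCost d = visitCost 0 + (2 + kidsBody.cost) * d := by
  simp only [visitCost]; omega

theorem drawProgram_spec {S : GraphStory (Fin n)} {E : List (Fin n × Fin n)} {hn : 0 < n}
    (hE : IsEdgeList S.graph E) (hlen : E.length + 1 = n)
    (D : IsSetting S.window S.time ⟨0, hn⟩ par S.bucket dep ray (adjOf E.reverse)) {B : ℕ}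
    (hB : 20 * n + 20 * S.window ≤ B) :
    Reaches B drawProgram (inputMemory S E) (drawConst * n) fun m' =>
        ∃ st', Inv ⟨0, hn⟩ par S.bucket dep st' ∧ st'.stk = [] ∧ st'.que = [] ∧
          Rep S.window S.time ⟨0, hn⟩ par S.bucket dep ray (adjOf E.reverse) m' st' := by
  have hbuild := build_spec (n := n) (B := B) (m₀ := inputMemory S E) (E := E) (by omega) hlen
    (by simp [inputMemory]) (fun i h => by simp [inputMemory, h])
    (fun i h => by simp [inputMemory, h]) (fun e he => hE.fst_ne_snd he) E.length 0 (by simp)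
    (inputMemory S E)
    ⟨fun _ _ => rfl, by simp [inputMemory], fun _ _ _ _ => rfl,
      fun v => by simp [inputMemory, adjOf, Chain]⟩
  have hfinal := hbuild.seq (q := .seq (.assign 5 (.lit 1)) (.loop visitCond visitBody))
    (R := fun m' => ∃ st', Inv ⟨0, hn⟩ par S.bucket dep st' ∧ st'.stk = [] ∧ st'.que = [] ∧
          Rep S.window S.time ⟨0, hn⟩ par S.bucket dep ray (adjOf E.reverse) m' st')
    (T' := 2 + (∑ v : Fin n, visitCost (adjOf E.reverse v).length + (visitCond.steps + 1))) ?_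
  · refine hfinal.mono ?_ fun _ h => h
    have hsum : ∑ v : Fin n, visitCost (adjOf E.reverse v).length =
        n * visitCost 0 + (2 + kidsBody.cost) * (2 * E.length) := by
      simp only [visitCost_eq (List.length _), Finset.sum_add_distrib, ← Finset.mul_sum,
        sum_length_adjOf, List.length_reverse]
      simp
    rw [hsum, drawConst]
    generalize buildCond.steps + 1 + buildBody.cost = a
    generalize buildCond.steps + 1 = b
    generalize visitCost 0 = c
    generalize 2 + kidsBody.cost = d
    generalize visitCond.steps + 1 = e
    obtain ⟨l, hl⟩ : ∃ l, E.length = l := ⟨_, rfl⟩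
    rw [hl] at hlen ⊢
    rw [← hlen]
    nlinarith [Nat.zero_le (b * l), Nat.zero_le (e * l)]
  · intro m' hm
    obtain ⟨v1, v2, v3, v4⟩ := hm
    refine Reaches.seq (Q := fun m'' => m'' = m'.setVar 5 1)
      (Reaches.of_exec (p := .assign 5 (.lit 1)) ?_ rfl) ?_
    · simp only [Program.Ok, Expr.Fits]; omega
    · rintro _ rfl
      -- Setting the queue end to `1` enqueues the root, since the first queue cell still holds `0`.
      refine (visitLoop_spec D hB n (st := ⟨[], [], [⟨0, hn⟩], fun _ => 0⟩) (by simp) ?_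
        (inv_init _)).mono (by simp) fun _ h => h
      refine ⟨⟨?_, ?_, ?_, ?_, ?_, ?_, ?_, ?_, ?_⟩, ⟨?_, ?_⟩⟩
      · simp [Memory.setVar, v1 1, inputMemory]
      · simp [Memory.setVar, v3 0, inputMemory]
      · intro v
        have := v4 v
        rw [List.take_length] at this
        exact this.congr (by omega) (fun _ _ => rfl) (fun _ _ => rfl)
      · simp [Memory.setVar, v1 3, inputMemory]
      · trivial
      · simp [Memory.setVar, v1 4, inputMemory]
      · simp [Memory.setVar, v3 13, inputMemory, IsQueue]
      · simp [Memory.setVar, v1 4, inputMemory]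
      · intro v hv
        have hv' : v = ⟨0, hn⟩ := by simpa using hv
        subst hv'
        simp [Memory.setVar, v3 8, v3 9, v3 10, inputMemory, D.par_root, D.dep_root, D.ray_root]
      · simp [Memory.setVar, v3 11, inputMemory, count]
      · simp

end StoryDrawing

theorem theorem3 :
    ∃ (P : StoryDrawing.Program) (C : ℕ),
      ∀ (n : ℕ) (S : StoryDrawing.GraphStory (Fin n)) (E : List (Fin n × Fin n)),
        S.IsTreeStory → StoryDrawing.IsEdgeList S.graph E →
        ∃ (m : StoryDrawing.Memory) (t : ℕ) (Γ : StoryDrawing.DrawingStory S),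
          StoryDrawing.Run (C * (n + S.window)) P (StoryDrawing.inputMemory S E) m t ∧
          t ≤ C * n ∧
          StoryDrawing.Represents m Γ ∧
          Γ.Planar ∧ Γ.StraightLine ∧
          Γ.LiesOnGridOfSize (8 * S.window + 1) (8 * S.window + 1) := by
  refine ⟨StoryDrawing.drawProgram, StoryDrawing.drawConst, fun n S E hS hE => ?_⟩
  have hlen : E.length + 1 = n := by
    simpa using StoryDrawing.IsEdgeList.length_eq hS hE
  have hn : 0 < n := by omega
  obtain ⟨par, dep, ray, D, hadj⟩ := StoryDrawing.exists_setting hS hE hn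
  -- The summand `20` of `drawConst` is there for this word bound; the others pay for the steps.
  have hB : 20 * n + 20 * S.window ≤ StoryDrawing.drawConst * (n + S.window) := by
    rw [← Nat.mul_add]
    exact Nat.mul_le_mul_right _ (by simp only [StoryDrawing.drawConst]; omega)
  obtain ⟨m, t, hrun, ht, st, I, hstk, hque, R⟩ := StoryDrawing.drawProgram_spec hE hlen D hB
  have L := I.isLayout D.tree hstk hque (I.count_le S.card_bucket_le)
    (by rw [D.ray_root]; simp) D.ray_eq
  refine ⟨m, t, StoryDrawing.layoutStory L, hrun, ht,
    ⟨StoryDrawing.layoutStory_straightLine L, fun _ v _ => ?_⟩,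
    StoryDrawing.layoutStory_planar L hadj, StoryDrawing.layoutStory_straightLine L,
    StoryDrawing.layoutStory_liesOnGrid L⟩
  have h := R.out v (I.all_visited D.tree hstk hque v)
  show ((_ : ℝ), (_ : ℝ)) = _
  rw [← h]
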